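/- All Banach spaces are real, and $c_{00}$ is the space of finitely supported real sequences. A sequence $(x_i)_{i\in\mathbb N}$ in a Banach space is *normalized* if $\|x_i\|=1$ for all $i$. It is *unconditional with constant $C$* if all $x_i\neq 0$ and $\bigl\|\sum_{i\in E}a_ix_i\bigr\|\le C\bigl\|\sum_i a_ix_i\bigr\|$ for all $(a_i)\in c_{00}$ and all finite $E\subset\mathbb N$. Sequences $(x_i)$ and $(y_i)$ are *$K$-equivalent* if there are $A,B>0$ with $B/A\le K$ and $A\bigl\|\sum a_ix_i\bigr\|\le\bigl\|\sum a_iy_i\bigr\|\le B\bigl\|\sum a_ix_i\bigr\|$ for all $(a_i)\in c_{00}$; they are *equivalent* if they are $K$-equivalent for some $K$. Infima of sets of constants are taken in $[0,\infty]$, with $\inf\emptyset=\infty$. Let $\delta\in(0,1]$. For a normalized weakly null sequence $(x_i)$ let $L((x_i),\delta)$ be the infimum of the constants $C$ such that $$\Bigl\|\sum_{i\in E}a_ix_i\Bigr\|\le C\,\Bigl\|\sum_i a_ix_i\Bigr\|$$ for all finite $E\subset\mathbb N$ and all $(a_i)\in c_{00}$ with $|a_i|\ge\delta$ whenever $a_i\neq0$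 and $\sup_i|a_i|\le 1$. Let $L'((x_i),\delta)$ be defined in the same way with the condition $\sup_i|a_i|\le1$ replaced by $\bigl\|\sum_i a_ix_i\bigr\|\le1$. Put $$L(\delta)=\sup_{(y_i)}\ \inf_{(z_i)\subset(y_i)}L((z_i),\delta),\qquad L'(\delta)=\sup_{(y_i)}\ \inf_{(z_i)\subset(y_i)}L'((z_i),\delta),$$ where the suprema are over all normalized weakly null sequences $(y_i)$ in Banach spaces and the infima over all subsequences $(z_i)$ of $(y_i)$. Let $C(\delta)$ be the infimum of the constants $C$ such that every normalized sequence in a Banach space that is $1/\delta$-equivalent to the unit vector basis of $c_0$ has an unconditional subsequence with constant $C$. **Theorem 5.1.** Let $\delta,\delta_1\in(0,1]$. (i) If $\delta_1\le\delta$, then $C(\delta)\le L(\delta_1)\Bigl(1+\dfrac{\delta_1}{\delta}\Bigr)+\dfrac{\delta_1}{\delta}$. (ii) If $\delta_1<\dfrac{\delta}{2L'(\delta)}$ (the right-hand side being read as $0$ if $L'(\delta)=\infty$), then $L'(\delta)\le C(\delta_1)$. In particular, $$\sup_{0<\delta\le1}C(\delta)=\sup_{0<\delta\le1}L'(\delta)=\sup_{0<\delta\le1}L(\delta)$$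 in $[0,\infty]$. Consequently, there is a real number $C$ such that every sequence in a Banach space equivalent to the unit vector basis of $c_0$ has an unconditional subsequence with constant $C$ if and only if $\sup_{0<\delta\le1}L(\delta)<\infty$. -/

import Mathlib

universe u v

namespace C0Problem

open Filter Topology
open scoped ENNReal NNReal ZeroAtInfty

noncomputable section

/- Scalars are real. The space `c₀₀` of finitely supported scalar sequences is `ℕ →₀ ℝ`, and
`∑ᵢ aᵢ xᵢ` is `Finsupp.linearCombination ℝ x a`. A subsequence of `x : ℕ → X` is `x ∘ φ` with
`φ : ℕ → ℕ` strictly increasing. -/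

/-- A sequence of vectors of norm one. -/
def Normalized {X : Type u} [NormedAddCommGroup X] (x : ℕ → X) : Prop :=
  ∀ i, ‖x i‖ = 1

/-- A sequence converging to zero in the weak topology. -/
def WeaklyNull {X : Type u} [NormedAddCommGroup X] [NormedSpace ℝ X] (x : ℕ → X) : Prop :=
  ∀ f : X →L[ℝ] ℝ, Tendsto (fun i => f (x i)) atTop (𝓝 0)

/-- `(xᵢ)` and `(yᵢ)` are `K`-equivalent: there are `A, B > 0` with `B / A ≤ K` and
`A ‖∑ aᵢ xᵢ‖ ≤ ‖∑ aᵢ yᵢ‖ ≤ B ‖∑ aᵢ xᵢ‖` for all `a ∈ c₀₀`. -/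
def EquivalentWith {X : Type u} [NormedAddCommGroup X] [NormedSpace ℝ X]
    {Y : Type v} [NormedAddCommGroup Y] [NormedSpace ℝ Y]
    (K : ℝ) (x : ℕ → X) (y : ℕ → Y) : Prop :=
  ∃ A B : ℝ, 0 < A ∧ 0 < B ∧ B / A ≤ K ∧ ∀ a : ℕ →₀ ℝ,
    A * ‖Finsupp.linearCombination ℝ x a‖ ≤ ‖Finsupp.linearCombination ℝ y a‖ ∧
    ‖Finsupp.linearCombination ℝ y a‖ ≤ B * ‖Finsupp.linearCombination ℝ x a‖

/-- The unit vector basis of `c₀`, the space of real sequences tending to zero with the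
supremum norm. -/
def c0Basis (n : ℕ) : C₀(ℕ, ℝ) where
  toFun := Pi.single n 1
  continuous_toFun := continuous_of_discreteTopology
  zero_at_infty' := by
    rw [Filter.cocompact_eq_cofinite]
    refine tendsto_nhds_of_eventually_eq ?_
    filter_upwards [(Set.finite_singleton n).compl_mem_cofinite] with i hi
    exact Pi.single_eq_of_ne (by simpa using hi) 1

/-- `(xᵢ)` is unconditional with constant `C`: it consists of non-zero vectors and projections
onto finite sets of coordinates have norm at most `C`. -/
def UnconditionalWith {X : Type u} [NormedAddCommGroup X] [NormedSpace ℝ X]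
    (C : ℝ) (x : ℕ → X) : Prop :=
  (∀ i, x i ≠ 0) ∧ ∀ (a : ℕ →₀ ℝ) (E : Finset ℕ),
    ‖∑ i ∈ E, a i • x i‖ ≤ C * ‖Finsupp.linearCombination ℝ x a‖

/-- The constant `L((xᵢ), δ)`, with value `∞` if no constant works: coefficients are bounded by
one and the non-zero ones have modulus at least `δ`. -/
def LSeq {X : Type u} [NormedAddCommGroup X] [NormedSpace ℝ X] (x : ℕ → X) (δ : ℝ) : ℝ≥0∞ :=
  ⨅ (C : ℝ≥0) (_ : ∀ (a : ℕ →₀ ℝ) (E : Finset ℕ),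
    (∀ i ∈ a.support, δ ≤ |a i|) → (∀ i, |a i| ≤ 1) →
    ‖∑ i ∈ E, a i • x i‖ ≤ C * ‖Finsupp.linearCombination ℝ x a‖), (C : ℝ≥0∞)

/-- The constant `L'((xᵢ), δ)`, with value `∞` if no constant works: the vector has norm at most
one and its non-zero coefficients have modulus at least `δ`. -/
def LSeq' {X : Type u} [NormedAddCommGroup X] [NormedSpace ℝ X] (x : ℕ → X) (δ : ℝ) : ℝ≥0∞ :=
  ⨅ (C : ℝ≥0) (_ : ∀ (a : ℕ →₀ ℝ) (E : Finset ℕ),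
    (∀ i ∈ a.support, δ ≤ |a i|) → ‖Finsupp.linearCombination ℝ x a‖ ≤ 1 →
    ‖∑ i ∈ E, a i • x i‖ ≤ C * ‖Finsupp.linearCombination ℝ x a‖), (C : ℝ≥0∞)

/-- `L(δ)`: supremum over all normalized weakly null sequences in Banach spaces of the infimum
of `L(·, δ)` over subsequences. -/
def L (δ : ℝ) : ℝ≥0∞ :=
  ⨆ (X : Type u) (_ : NormedAddCommGroup X) (_ : NormedSpace ℝ X) (_ : CompleteSpace X)
    (x : ℕ → X) (_ : Normalized x) (_ : WeaklyNull x),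
    ⨅ (φ : ℕ → ℕ) (_ : StrictMono φ), LSeq (x ∘ φ) δ

/-- `L'(δ)`: supremum over all normalized weakly null sequences in Banach spaces of the infimum
of `L'(·, δ)` over subsequences. -/
def L' (δ : ℝ) : ℝ≥0∞ :=
  ⨆ (X : Type u) (_ : NormedAddCommGroup X) (_ : NormedSpace ℝ X) (_ : CompleteSpace X)
    (x : ℕ → X) (_ : Normalized x) (_ : WeaklyNull x),
    ⨅ (φ : ℕ → ℕ) (_ : StrictMono φ), LSeq' (x ∘ φ) δ

/-- `C(δ)`: infimum of the constants `C` such that every normalized sequence in a Banach space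
that is `1/δ`-equivalent to the unit vector basis of `c₀` has an unconditional subsequence with
constant `C` (with value `∞` if there is none). -/
def C (δ : ℝ) : ℝ≥0∞ :=
  ⨅ (C : ℝ≥0) (_ : ∀ (X : Type u) [NormedAddCommGroup X] [NormedSpace ℝ X] [CompleteSpace X]
    (x : ℕ → X), Normalized x → EquivalentWith (1 / δ) c0Basis x →
    ∃ φ : ℕ → ℕ, StrictMono φ ∧ UnconditionalWith C (x ∘ φ)), (C : ℝ≥0∞)

/-- A positive answer to the `c₀`-problem: for some constant `C`, every sequence in a Banach
space equivalent to the unit vector basis of `c₀` (not necessarily normalized) has an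
unconditional subsequence with constant `C`. -/
def C0ProblemPositive : Prop :=
  ∃ C : ℝ, ∀ (X : Type u) [NormedAddCommGroup X] [NormedSpace ℝ X] [CompleteSpace X]
    (x : ℕ → X), (∃ K : ℝ, EquivalentWith K c0Basis x) →
    ∃ φ : ℕ → ℕ, StrictMono φ ∧ UnconditionalWith C (x ∘ φ)

end

end C0Problem

namespace C0Problem

open Filter Topology
open scoped ENNReal NNReal ZeroAtInfty

/-! Three inequalities close a cycle: sup C ≤ sup L ≤ sup L' ≤ sup C.

C against L: a sequence equivalent to the basis of c₀ is weakly null, and the coefficients of a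
vector below δ₁ times its largest one contribute at most δ₁/δ of its norm. Only the large
coefficients need a suppression inequality (`EquivalentWith.unconditionalWith`).

L against L': a diagonal subsequence has its k-th tail controlled at a level δ/τₖ. In a vector of
norm t the first ⌊εt⌋ coordinates are negligible, and the rest, scaled into the unit ball, falls
under the control of that tail (`exists_subseq_nearUnconditional`).

L' against C: the space is renormed. If the suppression inequality holds with constant Λ, a
functional of norm at most one has ℓ₁-mass at most 2Λ/δ on the support of an admissible vector.
Norming only by functionals whose total mass along the sequence barely exceeds this bound gives a
sequence equivalent to the basis of c₀ (`exists_equivalentWith_c0Basis`). Failures of the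
suppression inequality must survive, so the functionals witnessing them must be nearly zero off the
relevant supports. The matching lemma `exists_subseq_matching` provides this, using Galvin's
dichotomy for finite sets and weak* compactness of the dual ball. The same lemma yields Elton's
theorem, that is, L'(δ) < ∞, so that a suitable δ₁ always exists. -/

/-! ### Fusion and Galvin's dichotomy -/

/-- `F` is an initial segment of `S`. -/
def IsInit (F : Finset ℕ) (S : Set ℕ) : Prop :=
  ↑F ⊆ S ∧ ∀ i ∈ S, ∀ j ∈ F, i ≤ j → i ∈ F

theorem IsInit.comparable {F G : Finset ℕ} {S : Set ℕ} (hF : IsInit F S) (hG : IsInit G S) :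
    IsInit F (G : Set ℕ) ∨ IsInit G (F : Set ℕ) := by
  by_cases h : F ⊆ G
  · exact Or.inl ⟨by exact_mod_cast h, fun i hi j hj hij => hF.2 i (hG.1 hi) j hj hij⟩
  · obtain ⟨a, haF, haG⟩ := Finset.not_subset.1 h
    have hGF : G ⊆ F := fun i hi => by
      rcases le_total i a with h1 | h1
      · exact hF.2 i (hG.1 hi) a haF h1
      · exact absurd (hG.2 a (hF.1 haF) i hi h1) haG
    exact Or.inr ⟨by exact_mod_cast hGF, fun i hi j hj hij => hG.2 i (hF.1 hi) j hj hij⟩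

theorem infinite_inter_Ioi {M : Set ℕ} (hM : M.Infinite) (p : ℕ) : (M ∩ Set.Ioi p).Infinite := by
  intro h
  refine hM ((h.union (Set.finite_Iic p)).subset fun i hi => ?_)
  rcases lt_or_ge p i with h1 | h1
  · exact Or.inl ⟨hi, h1⟩
  · exact Or.inr h1

/-- Diagonal construction of an infinite set by successive choices of elements. -/
theorem fusion {Q : Finset ℕ → Set ℕ → Prop}
    (mono : ∀ t M N, N ⊆ M → Q t M → Q t N)
    (step : ∀ t M, M.Infinite → (∀ i ∈ t, ∀ j ∈ M, i < j) → Q t M →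
      ∃ p ∈ M, ∃ N ⊆ M, N.Infinite ∧ (∀ j ∈ N, p < j) ∧ Q (insert p t) N)
    {M : Set ℕ} (hM : M.Infinite) (h0 : Q ∅ M) :
    ∃ φ : ℕ → ℕ, StrictMono φ ∧ (∀ k, φ k ∈ M) ∧
      ∀ k, Q ((Finset.range k).image φ) (φ '' Set.Ici k) := by
  let S := {s : Finset ℕ × Set ℕ //
    s.2.Infinite ∧ (∀ i ∈ s.1, ∀ j ∈ s.2, i < j) ∧ Q s.1 s.2}
  choose p hpM N hNM hNinf hpN hQ using step
  let pt : S → ℕ := fun s => p s.1.1 s.1.2 s.2.1 s.2.2.1 s.2.2.2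
  let next : S → S := fun s =>
    ⟨(insert (pt s) s.1.1, N s.1.1 s.1.2 s.2.1 s.2.2.1 s.2.2.2), hNinf _ _ _ _ _, by
      intro i hi j hj
      rcases Finset.mem_insert.1 hi with rfl | hi
      · exact hpN _ _ _ _ _ j hj
      · exact s.2.2.1 i hi j (hNM _ _ _ _ _ hj), hQ _ _ _ _ _⟩
  let s : ℕ → S := fun n => next^[n] ⟨(∅, M), hM, by simp, h0⟩
  have hs : ∀ n, s (n + 1) = next (s n) := fun n => Function.iterate_succ_apply' _ _ _
  have hsub : ∀ n, (s (n + 1)).1.2 ⊆ (s n).1.2 := fun n => by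
    rw [hs]; exact hNM _ _ _ _ _
  have hanti : Antitone fun n => (s n).1.2 := antitone_nat_of_succ_le hsub
  have hmem : ∀ n, pt (s n) ∈ (s n).1.2 := fun n => hpM _ _ _ _ _
  have hlt : ∀ n, ∀ j ∈ (s (n + 1)).1.2, pt (s n) < j := fun n j hj => by
    rw [hs] at hj; exact hpN _ _ _ _ _ j hj
  refine ⟨fun n => pt (s n), strictMono_nat_of_lt_succ fun n => hlt n _ (hmem _),
    fun k => hanti (Nat.zero_le k) (hmem k), fun k => ?_⟩
  have ht : ∀ k, (s k).1.1 = (Finset.range k).image fun n => pt (s n) := by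
    intro k
    induction k with
    | zero => rfl
    | succ k ih =>
      rw [Finset.range_add_one, Finset.image_insert, ← ih, hs]
  rw [← ht]
  refine mono _ _ _ ?_ (s k).2.2.2
  rintro _ ⟨n, hn, rfl⟩
  exact hanti hn (hmem n)

theorem exists_infinite_subset_forall {ι : Type*} (T : Finset ι) {P : ι → Set ℕ → Prop}
    (mono : ∀ i M N, N ⊆ M → P i M → P i N) {M : Set ℕ} (hM : M.Infinite)
    (dense : ∀ i ∈ T, ∀ N ⊆ M, N.Infinite → ∃ N' ⊆ N, N'.Infinite ∧ P i N') :
    ∃ N ⊆ M, N.Infinite ∧ ∀ i ∈ T, P i N := by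
  classical
  induction T using Finset.induction_on with
  | empty => exact ⟨M, subset_rfl, hM, by simp⟩
  | insert a T _ ih =>
    obtain ⟨N, hN, hNi, hNP⟩ := ih fun i hi => dense i (Finset.mem_insert_of_mem hi)
    obtain ⟨N', hN', hNi', hP⟩ := dense a (Finset.mem_insert_self _ _) N hN hNi
    refine ⟨N', hN'.trans hN, hNi', fun i hi => ?_⟩
    rcases Finset.mem_insert.1 hi with rfl | hi
    · exact hP
    · exact mono _ _ _ hN' (hNP i hi)

/-- Every infinite subset of `M` beyond `s` produces, together with `s`, a set with an initial
segment in `𝓑`. -/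
def Accepts (𝓑 : Set (Finset ℕ)) (s : Finset ℕ) (M : Set ℕ) : Prop :=
  ∀ N ⊆ M, N.Infinite → (∀ i ∈ s, ∀ j ∈ N, i < j) → ∃ F ∈ 𝓑, IsInit F (↑s ∪ N)

/-- No infinite subset of `M` accepts `s`. -/
def Rejects (𝓑 : Set (Finset ℕ)) (s : Finset ℕ) (M : Set ℕ) : Prop :=
  ∀ N ⊆ M, N.Infinite → ¬ Accepts 𝓑 s N

theorem Accepts.mono {𝓑 : Set (Finset ℕ)} {s : Finset ℕ} {M N : Set ℕ} (h : Accepts 𝓑 s M)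
    (hN : N ⊆ M) : Accepts 𝓑 s N := fun N' hN' => h N' (hN'.trans hN)

theorem Rejects.mono {𝓑 : Set (Finset ℕ)} {s : Finset ℕ} {M N : Set ℕ} (h : Rejects 𝓑 s M)
    (hN : N ⊆ M) : Rejects 𝓑 s N := fun N' hN' => h N' (hN'.trans hN)

theorem exists_accepts_or_rejects (𝓑 : Set (Finset ℕ)) (s : Finset ℕ) {M : Set ℕ}
    (hM : M.Infinite) : ∃ N ⊆ M, N.Infinite ∧ (Accepts 𝓑 s N ∨ Rejects 𝓑 s N) := by
  by_cases h : Rejects 𝓑 s M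
  · exact ⟨M, subset_rfl, hM, Or.inr h⟩
  · simp only [Rejects, not_forall, not_not] at h
    obtain ⟨N, hN, hi, hA⟩ := h
    exact ⟨N, hN, hi, Or.inl hA⟩

/-- Diagonalise so that each point `n`, adjoined to `s`, is decided by the points after it. If
infinitely many were accepted, they would form a set accepting `s`, because the least element of a
subset already decides it. So all but finitely many are rejected. -/
theorem Rejects.exists_insert {𝓑 : Set (Finset ℕ)} {s : Finset ℕ} {M : Set ℕ}
    (hM : M.Infinite) (h : Rejects 𝓑 s M) :
    ∃ N ⊆ M, N.Infinite ∧ ∀ n ∈ N, Rejects 𝓑 (insert n s) N := by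
  obtain ⟨φ, hφ, hφM, hQ⟩ := fusion
    (Q := fun t M => ∀ n ∈ t, Accepts 𝓑 (insert n s) M ∨ Rejects 𝓑 (insert n s) M)
    (fun t M N hN hQ n hn => (hQ n hn).imp (fun h => h.mono hN) fun h => h.mono hN)
    (by
      intro t M hM _ hQ
      obtain ⟨p, hp⟩ := hM.nonempty
      obtain ⟨N, hN, hNi, hd⟩ :=
        exists_accepts_or_rejects 𝓑 (insert p s) (infinite_inter_Ioi hM p)
      refine ⟨p, hp, N, fun i hi => (hN hi).1, hNi, fun j hj => (hN hj).2, fun n hn => ?_⟩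
      rcases Finset.mem_insert.1 hn with rfl | hn
      · exact hd
      · exact (hQ n hn).imp (fun h => h.mono fun i hi => (hN hi).1)
          fun h => h.mono fun i hi => (hN hi).1) hM (by simp)
  have hd : ∀ k, Accepts 𝓑 (insert (φ k) s) (φ '' Set.Ici (k + 1)) ∨
      Rejects 𝓑 (insert (φ k) s) (φ '' Set.Ici (k + 1)) := fun k =>
    hQ (k + 1) (φ k) (Finset.mem_image_of_mem _ (Finset.self_mem_range_succ k))
  let I : Set ℕ := {k | Accepts 𝓑 (insert (φ k) s) (φ '' Set.Ici (k + 1))}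
  have htail : ∀ (J : Set ℕ) (k : ℕ) (N' : Set ℕ), N' ⊆ φ '' J →
      N' ∩ Set.Ioi (φ k) ⊆ φ '' Set.Ici (k + 1) := by
    rintro J k N' hN' i ⟨hi, hki⟩
    obtain ⟨l, _, rfl⟩ := hN' hi
    exact ⟨l, Nat.succ_le_of_lt (hφ.lt_iff_lt.1 hki), rfl⟩
  by_cases hI : I.Infinite
  · refine absurd ?_ (h (φ '' I) (by rintro _ ⟨k, _, rfl⟩; exact hφM k)
      (hI.image hφ.injective.injOn))
    intro N' hN' hN'i hsN'
    have hn := Nat.sInf_mem hN'i.nonempty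
    obtain ⟨k, hk, hkn⟩ := hN' hn
    obtain ⟨F, hF, hFi⟩ := hk (N' ∩ Set.Ioi (φ k)) (htail I k N' hN')
      (infinite_inter_Ioi hN'i _) (by
        intro i hi j hj
        rcases Finset.mem_insert.1 hi with rfl | hi
        · exact hj.2
        · exact hsN' i hi j hj.1)
    refine ⟨F, hF, ?_⟩
    -- The point `φ k` is the minimum of `N'`, so splitting it off does not change the union with
    -- `s`.
    convert hFi using 1
    ext i
    simp only [Finset.coe_insert, Set.mem_union, Set.mem_insert_iff, Set.mem_inter_iff,
      Set.mem_Ioi]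
    constructor
    · rintro (hi | hi)
      · exact Or.inl (Or.inr hi)
      · rcases (Nat.sInf_le hi).eq_or_lt with h1 | h1
        · exact Or.inl (Or.inl (by rw [hkn, h1]))
        · exact Or.inr ⟨hi, by rwa [hkn]⟩
    · rintro ((rfl | hi) | hi)
      · exact Or.inr (by rw [hkn]; exact hn)
      · exact Or.inl hi
      · exact Or.inr hi.1
  · refine ⟨φ '' Iᶜ, by rintro _ ⟨k, _, rfl⟩; exact hφM k,
      (Set.not_infinite.1 hI).infinite_compl.image hφ.injective.injOn, ?_⟩
    rintro _ ⟨k, hk, rfl⟩ N' hN' hN'i hA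
    exact (hd k).resolve_left hk _ (htail _ k N' hN') (infinite_inter_Ioi hN'i _)
      (hA.mono Set.inter_subset_left)

/-- Galvin's dichotomy for families of finite sets of natural numbers. -/
theorem galvin (𝓑 : Set (Finset ℕ)) {M : Set ℕ} (hM : M.Infinite) :
    ∃ N ⊆ M, N.Infinite ∧ ((∀ F ∈ 𝓑, ¬ (F : Set ℕ) ⊆ N) ∨
      ∀ N' ⊆ N, N'.Infinite → ∃ F ∈ 𝓑, IsInit F N') := by
  obtain ⟨M₁, hM₁, hM₁i, hd⟩ := exists_accepts_or_rejects 𝓑 ∅ hM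
  rcases hd with hA | hR
  · exact ⟨M₁, hM₁, hM₁i, Or.inr fun N' hN' hi => by simpa using hA N' hN' hi (by simp)⟩
  obtain ⟨φ, hφ, hφM, hQ⟩ := fusion (Q := fun t M => ∀ s ⊆ t, Rejects 𝓑 s M)
    (fun t M N hN hQ s hs => (hQ s hs).mono hN)
    (by
      intro t M hM _ hQ
      obtain ⟨N, hN, hNi, hNP⟩ := exists_infinite_subset_forall t.powerset
        (P := fun s N => ∀ n ∈ N, Rejects 𝓑 (insert n s) N)
        (fun s M N hN h n hn => (h n (hN hn)).mono hN) hM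
        (fun s hs N hN hNi =>
          Rejects.exists_insert hNi ((hQ s (Finset.mem_powerset.1 hs)).mono hN))
      obtain ⟨p, hp⟩ := hNi.nonempty
      refine ⟨p, hN hp, N ∩ Set.Ioi p, Set.inter_subset_left.trans hN, infinite_inter_Ioi hNi p,
        fun j hj => hj.2, fun s hs => ?_⟩
      by_cases hps : p ∈ s
      · rw [← Finset.insert_erase hps]
        exact (hNP _ (Finset.mem_powerset.2 (Finset.subset_insert_iff.1 hs)) p hp).mono
          Set.inter_subset_left
      · exact (hQ s ((Finset.subset_insert_iff_of_notMem hps).1 hs)).mono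
          (Set.inter_subset_left.trans hN)) hM₁i
    (by
      intro s hs
      rwa [Finset.subset_empty.1 hs])
  refine ⟨Set.range φ, by rintro _ ⟨k, rfl⟩; exact hM₁ (hφM k),
    Set.infinite_range_of_injective hφ.injective, Or.inl fun F hF hFN => ?_⟩
  obtain ⟨F', rfl⟩ : ∃ F' : Finset ℕ, F = F'.image φ := by
    classical
    refine ⟨F.preimage φ hφ.injective.injOn, ?_⟩
    rw [Finset.image_preimage]
    exact (Finset.filter_true_of_mem fun i hi => hFN hi).symm
  obtain ⟨k, hk⟩ := F'.exists_nat_subset_range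
  -- A member of `𝓑` is accepted by every set, being an initial segment of its own end-extensions;
  -- but all finite subsets of the range are rejected.
  refine hQ k _ (Finset.image_subset_image hk) _ subset_rfl
    ((Set.Ici_infinite k).image hφ.injective.injOn) ?_
  intro N _ _ hlt
  refine ⟨_, hF, Set.subset_union_left, fun i hi j hj hij => ?_⟩
  rcases hi with hi | hi
  · exact hi
  · exact absurd (hlt j hj i hi) (not_lt.2 hij)

/-! ### Matching for thin families -/

/-- No member is a proper initial segment of another one. -/
def Thin (𝓖 : Set (Finset ℕ)) : Prop :=
  ∀ F ∈ 𝓖, ∀ G ∈ 𝓖, IsInit F (G : Set ℕ) → F = G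

/-- The members of `𝓖` inside `t ∪ M` admit matching elements of `K` that are small on `t`. -/
def MatchesOn (K : Set (ℕ → ℝ)) (𝓖 : Set (Finset ℕ)) (f : Finset ℕ → ℕ → ℝ) (η : ℕ → ℝ)
    (t : Finset ℕ) (M : Set ℕ) : Prop :=
  ∀ F ∈ 𝓖, (F : Set ℕ) ⊆ ↑t ∪ M →
    ∃ g ∈ K, (∀ i ∈ F, g i = f F i) ∧ ∑ i ∈ t \ F, |g i| ≤ η t.card

/-- A point of `M` can be added to `t` as a gap, for members of `𝓖` with trace `A` on `t`. -/
def GapsOn (K : Set (ℕ → ℝ)) (𝓖 : Set (Finset ℕ)) (f : Finset ℕ → ℕ → ℝ) (η : ℕ → ℝ)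
    (t A : Finset ℕ) (M : Set ℕ) : Prop :=
  ∀ p ∈ M, ∀ F : Finset ℕ, (F : Set ℕ) ⊆ M → (∀ i ∈ F, p < i) → A ∪ F ∈ 𝓖 →
    ∃ g ∈ K, (∀ i ∈ A ∪ F, g i = f (A ∪ F) i) ∧ ∑ i ∈ t \ (A ∪ F), |g i| ≤ η t.card ∧
      |g p| ≤ η (t.card + 1) - η t.card

theorem exists_mem_forall_le_of_isCompact {K : Set (ℕ → ℝ)} (hK : IsCompact K) {c : ℝ}
    {p : ℕ → ℕ} (h : ∀ r, ∃ g ∈ K, ∀ j < r, c ≤ |g (p j)|) : ∃ g ∈ K, ∀ j, c ≤ |g (p j)| := by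
  have hcl : ∀ r, IsClosed {g : ℕ → ℝ | ∀ j < r, c ≤ |g (p j)|} := fun r => by
    simp only [Set.ofPred_forall]
    exact isClosed_iInter fun j => isClosed_iInter fun _ =>
      isClosed_le continuous_const (continuous_apply (p j)).abs
  obtain ⟨g, hg⟩ := IsCompact.nonempty_iInter_of_sequence_nonempty_isCompact_isClosed
    (fun r => K ∩ {g : ℕ → ℝ | ∀ j < r, c ≤ |g (p j)|})
    (fun r g hg => ⟨hg.1, fun j hj => hg.2 j (hj.trans r.lt_succ_self)⟩)
    (fun r => let ⟨g, hg, h⟩ := h r; ⟨g, hg, h⟩) (hK.inter_right (hcl 0))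
    (fun r => hK.isClosed.inter (hcl r))
  rw [Set.mem_iInter] at hg
  exact ⟨g, (hg 0).1, fun j => (hg (j + 1)).2 j j.lt_succ_self⟩

/-- Otherwise Galvin's dichotomy gives an infinite set all of whose infinite subsets begin with a
bad pair `p`, `F`. Put any of `r` points in front of one common tail: thinness forces the same `A ∪
F` each time, so a single matching element of `K` is large at all `r` points. By compactness some
element of `K` is large at infinitely many points, though it is a null sequence. -/
theorem exists_gapsOn {K : Set (ℕ → ℝ)} (hK : IsCompact K)
    (hnull : ∀ g ∈ K, Tendsto g atTop (𝓝 0)) {𝓖 : Set (Finset ℕ)} (h𝓖 : Thin 𝓖)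
    {f : Finset ℕ → ℕ → ℝ} {η : ℕ → ℝ} (hη : StrictMono η) {t A : Finset ℕ} (hA : A ⊆ t)
    {M : Set ℕ} (hM : M.Infinite) (htM : ∀ i ∈ t, ∀ j ∈ M, i < j)
    (hQ : MatchesOn K 𝓖 f η t M) : ∃ N ⊆ M, N.Infinite ∧ GapsOn K 𝓖 f η t A N := by
  let Bad (p : ℕ) (H : Finset ℕ) : Prop := ∀ g ∈ K, (∀ i ∈ H, g i = f H i) →
    ∑ i ∈ t \ H, |g i| ≤ η t.card → η (t.card + 1) - η t.card < |g p|
  obtain ⟨N, hNM, hNi, h⟩ := galvin {G | ∃ p F, G = insert p F ∧ (∀ i ∈ F, p < i) ∧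
    A ∪ F ∈ 𝓖 ∧ Bad p (A ∪ F)} hM
  refine ⟨N, hNM, hNi, ?_⟩
  rcases h with h | h
  · intro p hp F hF hpF hAF
    by_contra hcon
    refine h (insert p F) ⟨p, F, rfl, hpF, hAF, fun g hg hgf hs => ?_⟩ (by
      rw [Finset.coe_insert]; exact Set.insert_subset hp hF)
    by_contra hgp
    exact hcon ⟨g, hg, hgf, hs, not_lt.1 hgp⟩
  exfalso
  have hc : 0 < η (t.card + 1) - η t.card := sub_pos.2 (hη (Nat.lt_succ_self _))
  let p : ℕ → ℕ := Nat.nth (· ∈ N)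
  have hp : StrictMono p := Nat.nth_strictMono hNi
  have hpN : ∀ k, p k ∈ N := fun k => Nat.nth_mem_of_infinite hNi k
  -- The bad initial segment of `{p j} ∪ {p k | k ≥ r}` is nonempty, hence its least point is `p j`.
  have key : ∀ r, ∀ j < r, ∃ F : Finset ℕ, IsInit F (p '' Set.Ici r) ∧ A ∪ F ∈ 𝓖 ∧
      Bad (p j) (A ∪ F) := by
    intro r j hj
    obtain ⟨G, ⟨q, F, rfl, hqF, hAF, hbad⟩, hsub, hinit⟩ := h (insert (p j) (p '' Set.Ici r))
      (Set.insert_subset (hpN j) (by rintro _ ⟨k, _, rfl⟩; exact hpN k))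
      (((Set.Ici_infinite r).image hp.injective.injOn).mono (Set.subset_insert _ _))
    have hlt : ∀ i ∈ p '' Set.Ici r, p j < i := by
      rintro _ ⟨k, hk, rfl⟩; exact hp (lt_of_lt_of_le hj hk)
    have hq : q ∈ insert (p j) (p '' Set.Ici r) := hsub (Finset.mem_coe.2
      (Finset.mem_insert_self _ _))
    have hle : p j ≤ q := by
      rcases hq with hq | hq
      · exact hq.ge
      · exact (hlt q hq).le
    have hmem := hinit (p j) (Set.mem_insert _ _) q (Finset.mem_insert_self _ _) hle
    have hqp : p j = q := by
      rcases Finset.mem_insert.1 hmem with h1 | h1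
      · exact h1
      · exact absurd (hqF _ h1) (not_lt.2 hle)
    subst hqp
    refine ⟨F, ⟨fun i hi => ?_, fun i hi l hl hil => ?_⟩, hAF, hbad⟩
    · rcases hsub (Finset.mem_coe.2 (Finset.mem_insert_of_mem hi)) with h1 | h1
      · exact absurd (hqF i hi) (by rw [h1]; exact lt_irrefl _)
      · exact h1
    · rcases Finset.mem_insert.1 (hinit i (Set.mem_insert_of_mem _ hi) l
        (Finset.mem_insert_of_mem hl) hil) with h1 | h1
      · exact absurd (hlt i hi) (by rw [h1]; exact lt_irrefl _)
      · exact h1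
  have huniq : ∀ {r : ℕ} {F G : Finset ℕ}, IsInit F (p '' Set.Ici r) → IsInit G (p '' Set.Ici r) →
      A ∪ F ∈ 𝓖 → A ∪ G ∈ 𝓖 → A ∪ F = A ∪ G := by
    have aux : ∀ {F G : Finset ℕ} {r : ℕ}, IsInit F (G : Set ℕ) → IsInit G (p '' Set.Ici r) →
        IsInit (A ∪ F) ((A ∪ G : Finset ℕ) : Set ℕ) := by
      intro F G r hFG hG
      refine ⟨by exact_mod_cast Finset.union_subset_union_right (by exact_mod_cast hFG.1),
        fun i hi j hj hij => ?_⟩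
      rcases Finset.mem_union.1 (Finset.mem_coe.1 hi) with h1 | h1
      · exact Finset.mem_union_left _ h1
      · rcases Finset.mem_union.1 hj with h2 | h2
        · obtain ⟨k, _, rfl⟩ := hG.1 h1
          exact absurd (htM j (hA h2) _ (hNM (hpN k))) (not_lt.2 hij)
        · exact Finset.mem_union_right _ (hFG.2 i h1 j h2 hij)
    intro r F G hF hG h1 h2
    rcases hF.comparable hG with h3 | h3
    · exact h𝓖 _ h1 _ h2 (aux h3 hG)
    · exact (h𝓖 _ h2 _ h1 (aux h3 hF)).symm
  obtain ⟨g, hgK, hg⟩ := exists_mem_forall_le_of_isCompact hK (c := η (t.card + 1) - η t.card)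
    (p := p) (by
      -- Positivity of `r` supplies an index at which to read off the common set `F`.
      have hpos : ∀ r, 0 < r → ∃ g ∈ K, ∀ j < r, η (t.card + 1) - η t.card ≤ |g (p j)| := by
        intro r hr
        obtain ⟨F, hF, hAF, -⟩ := key r 0 hr
        obtain ⟨g, hg, hgf, hs⟩ := hQ _ hAF (by
          rw [Finset.coe_union]
          refine Set.union_subset_union (by exact_mod_cast hA) (hF.1.trans ?_)
          rintro _ ⟨k, _, rfl⟩
          exact hNM (hpN k))
        refine ⟨g, hg, fun j hj => ?_⟩
        obtain ⟨G, hG, hAG, hbad⟩ := key r j hj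
        rw [huniq hG hF hAG hAF] at hbad
        exact (hbad g hg hgf hs).le
      intro r
      obtain ⟨g, hg, h⟩ := hpos (r + 1) r.succ_pos
      exact ⟨g, hg, fun j hj => h j (hj.trans r.lt_succ_self)⟩)
  have hlim := ((hnull g hgK).comp hp.tendsto_atTop).abs
  rw [abs_zero] at hlim
  exact absurd (ge_of_tendsto' hlim hg) (not_le.2 hc)

/-- Matching lemma: along a suitable subsequence the elements of a compact set of null sequences
attached to a thin family can be modified so as to be small off the members of the family. -/
theorem exists_subseq_matching_of_thin {K : Set (ℕ → ℝ)} (hK : IsCompact K)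
    (hnull : ∀ g ∈ K, Tendsto g atTop (𝓝 0)) {𝓖 : Set (Finset ℕ)} (h𝓖 : Thin 𝓖)
    {f : Finset ℕ → ℕ → ℝ} (hf : ∀ F ∈ 𝓖, f F ∈ K) {ε : ℝ} (hε : 0 < ε) :
    ∃ φ : ℕ → ℕ, StrictMono φ ∧ ∀ F ∈ 𝓖, (F : Set ℕ) ⊆ Set.range φ →
      ∃ g ∈ K, (∀ i ∈ F, g i = f F i) ∧
        ∀ s : Finset ℕ, (s : Set ℕ) ⊆ Set.range φ → Disjoint s F → ∑ i ∈ s, |g i| ≤ ε := by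
  classical
  -- Error budget after `k` chosen points: it starts at 0, increases strictly and never exceeds `ε`.
  let η : ℕ → ℝ := fun k => ε * (1 - (1 / 2) ^ k)
  have hη : StrictMono η := strictMono_nat_of_lt_succ fun k => by
    have : (0 : ℝ) < (1 / 2) ^ k := by positivity
    simp only [η, pow_succ]
    nlinarith
  have hηε : ∀ k, η k ≤ ε := fun k => by
    have : (0 : ℝ) < (1 / 2) ^ k := by positivity
    simp only [η]
    nlinarith
  obtain ⟨φ, hφ, -, hQ⟩ := fusion (Q := MatchesOn K 𝓖 f η)
    (fun t M N hN h F hF hFN => h F hF (hFN.trans (Set.union_subset_union_right _ hN)))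
    (by
      intro t M hM htM hQ
      obtain ⟨N, hNM, hNi, hgap⟩ := exists_infinite_subset_forall t.powerset
        (P := GapsOn K 𝓖 f η t)
        (fun A M N hN h p hp F hF => h p (hN hp) F (hF.trans hN)) hM
        (fun A hA N hN hNi => exists_gapsOn hK hnull h𝓖 hη (Finset.mem_powerset.1 hA) hNi
          (fun i hi j hj => htM i hi j (hN hj))
          (fun F hF hFN => hQ F hF (hFN.trans (Set.union_subset_union_right _ hN))))
      obtain ⟨p, hp⟩ := hNi.nonempty
      refine ⟨p, hNM hp, N ∩ Set.Ioi p, Set.inter_subset_left.trans hNM, infinite_inter_Ioi hNi p,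
        fun j hj => hj.2, fun F hF hFs => ?_⟩
      have hpt : p ∉ t := fun h => lt_irrefl _ (htM p h p (hNM hp))
      rw [Finset.card_insert_of_notMem hpt]
      -- If `p ∈ F` the sum off `F` is unchanged; if not, `p` is a gap, handled by the trace `F ∩ t`
      -- and paid for by the next increment of `η`.
      by_cases hpF : p ∈ F
      · obtain ⟨g, hg, hgf, hs⟩ := hQ F hF (fun i hi => by
          rcases hFs hi with h1 | h1
          · rcases Finset.mem_insert.1 (Finset.mem_coe.1 h1) with rfl | h1
            · exact Or.inr (hNM hp)
            · exact Or.inl h1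
          · exact Or.inr (hNM h1.1))
        refine ⟨g, hg, hgf, ?_⟩
        rw [Finset.insert_sdiff_of_mem _ hpF]
        exact hs.trans (hη (Nat.lt_succ_self _)).le
      · have hFd : F = (F ∩ t) ∪ (F \ t) := by
          ext i; simp only [Finset.mem_union, Finset.mem_inter, Finset.mem_sdiff]; tauto
        have hrest : ∀ i ∈ F \ t, i ∈ N ∩ Set.Ioi p := fun i hi => by
          obtain ⟨hiF, hit⟩ := Finset.mem_sdiff.1 hi
          rcases hFs hiF with h1 | h1
          · rcases Finset.mem_insert.1 (Finset.mem_coe.1 h1) with rfl | h1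
            · exact absurd hiF hpF
            · exact absurd h1 hit
          · exact h1
        obtain ⟨g, hg, hgf, hs, hgp⟩ := hgap (F ∩ t)
          (Finset.mem_powerset.2 Finset.inter_subset_right) p hp (F \ t)
          (fun i hi => (hrest i hi).1) (fun i hi => (hrest i hi).2) (by rwa [← hFd])
        rw [← hFd] at hgf hs
        refine ⟨g, hg, hgf, ?_⟩
        rw [Finset.insert_sdiff_of_notMem _ hpF, Finset.sum_insert (by simp [hpt])]
        linarith) Set.infinite_univ
    (fun F hF _ => ⟨f F, hf F hF, fun _ _ => rfl, by simp [η]⟩)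
  refine ⟨φ, hφ, fun F hF hFφ => ?_⟩
  -- Each stage gives its own matching element; compactness of `K` extracts one valid for all
  -- stages.
  let S : ℕ → Set (ℕ → ℝ) := fun k => {g | (∀ i ∈ F, g i = f F i) ∧
    ∑ i ∈ (Finset.range k).image φ \ F, |g i| ≤ ε}
  have hcl : ∀ k, IsClosed (S k) := fun k => by
    have h1 : IsClosed {g : ℕ → ℝ | ∀ i ∈ F, g i = f F i} := by
      simp only [Set.ofPred_forall]
      exact isClosed_iInter fun i => isClosed_iInter fun _ =>
        isClosed_eq (continuous_apply i) continuous_const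
    exact h1.inter (isClosed_le (continuous_finsetSum _ fun i _ => (continuous_apply i).abs)
      continuous_const)
  obtain ⟨g, hg⟩ := IsCompact.nonempty_iInter_of_sequence_nonempty_isCompact_isClosed
    (fun k => K ∩ S k)
    (fun k g hg => ⟨hg.1, hg.2.1, (Finset.sum_le_sum_of_subset_of_nonneg
      (Finset.sdiff_subset_sdiff (Finset.image_subset_image
        (Finset.range_subset_range.2 k.le_succ)) subset_rfl)
      fun _ _ _ => abs_nonneg _).trans hg.2.2⟩)
    (fun k => by
      obtain ⟨g, hg, hgf, hs⟩ := hQ k F hF (fun i hi => by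
        obtain ⟨l, rfl⟩ := hFφ hi
        rcases lt_or_ge l k with h | h
        · exact Or.inl (Finset.mem_coe.2 (Finset.mem_image_of_mem _ (Finset.mem_range.2 h)))
        · exact Or.inr ⟨l, h, rfl⟩)
      exact ⟨g, hg, hgf, hs.trans (hηε _)⟩)
    (hK.inter_right (hcl 0)) (fun k => hK.isClosed.inter (hcl k))
  rw [Set.mem_iInter] at hg
  refine ⟨g, (hg 0).1, (hg 0).2.1, fun s hs hsF => ?_⟩
  obtain ⟨s', rfl⟩ : ∃ s' : Finset ℕ, s = s'.image φ := by
    refine ⟨s.preimage φ hφ.injective.injOn, ?_⟩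
    rw [Finset.image_preimage]
    exact (Finset.filter_true_of_mem fun i hi => hs hi).symm
  obtain ⟨k, hk⟩ := s'.exists_nat_subset_range
  refine (Finset.sum_le_sum_of_subset_of_nonneg ?_ fun _ _ _ => abs_nonneg _).trans (hg k).2.2
  rw [Finset.subset_sdiff]
  exact ⟨Finset.image_subset_image hk, hsF⟩

/-! ### Matching for functionals -/

theorem Normalized.comp {X : Type u} [NormedAddCommGroup X] {x : ℕ → X} (hx : Normalized x)
    (φ : ℕ → ℕ) : Normalized (x ∘ φ) :=
  fun i => hx (φ i)

section
variable {X : Type u} [NormedAddCommGroup X] [NormedSpace ℝ X]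

theorem WeaklyNull.comp {x : ℕ → X} (hx : WeaklyNull x) {φ : ℕ → ℕ} (hφ : StrictMono φ) :
    WeaklyNull (x ∘ φ) := fun f => (hx f).comp hφ.tendsto_atTop

/-- The continuous image of the dual ball, which is weak* compact by Banach–Alaoglu. -/
theorem isCompact_range_evaluations (x : ℕ → X) :
    IsCompact {h : ℕ → ℝ | ∃ f : X →L[ℝ] ℝ, ‖f‖ ≤ 1 ∧ h = fun i => f (x i)} := by
  have hcont : Continuous fun (f : WeakDual ℝ X) (i : ℕ) => f (x i) :=
    continuous_pi fun i => WeakDual.eval_continuous (x i)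
  convert (WeakDual.isCompact_closedBall (𝕜 := ℝ) (0 : StrongDual ℝ X) 1).image hcont using 1
  ext h
  constructor
  · rintro ⟨f, hf, rfl⟩
    exact ⟨StrongDual.toWeakDual f, by simpa using hf, rfl⟩
  · rintro ⟨f, hf, rfl⟩
    exact ⟨WeakDual.toStrongDual f, by simpa using hf, rfl⟩

/-- Matching lemma for functionals: a finite set of indices carrying a functional with property
`P` has a subset carrying such a functional that is nearly zero off this subset. -/
theorem exists_subseq_matching {x : ℕ → X} (hx : WeaklyNull x)
    (P : Finset ℕ → (X →L[ℝ] ℝ) → Prop) (hP : ∀ F f, P F f → ‖f‖ ≤ 1)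
    (hcongr : ∀ F f g, P F f → ‖g‖ ≤ 1 → (∀ i ∈ F, g (x i) = f (x i)) → P F g)
    {ε : ℝ} (hε : 0 < ε) :
    ∃ φ : ℕ → ℕ, StrictMono φ ∧ ∀ F f, P (F.image φ) f → ∃ F' ⊆ F, ∃ g, P (F'.image φ) g ∧
      ∀ s, Disjoint s F' → ∑ i ∈ s, |g (x (φ i))| ≤ ε := by
  classical
  let 𝓕 : Set (Finset ℕ) := {F | ∃ f, P F f}
  -- Members minimal for the initial segment order form a thin family, and each set in `𝓕` contains
  -- one of them. This is why the matching functional lives on a subset of the given set.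
  let 𝓖 : Set (Finset ℕ) := {F | F ∈ 𝓕 ∧ ∀ G ∈ 𝓕, IsInit G (F : Set ℕ) → G = F}
  have h𝓖 : Thin 𝓖 := fun F hF G hG h => hG.2 F hF.1 h
  have hmin : ∀ n, ∀ F ∈ 𝓕, F.card = n → ∃ G ∈ 𝓖, G ⊆ F := by
    intro n
    induction n using Nat.strong_induction_on with
    | _ n ih =>
      intro F hF hn
      by_cases h : F ∈ 𝓖
      · exact ⟨F, h, subset_rfl⟩
      · have h' : ∃ G ∈ 𝓕, IsInit G (F : Set ℕ) ∧ G ≠ F := by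
          by_contra hcon
          push Not at hcon
          exact h ⟨hF, hcon⟩
        obtain ⟨G, hG, hGF, hne⟩ := h'
        have hss : G ⊂ F := (Finset.ssubset_iff_subset_ne).2 ⟨by exact_mod_cast hGF.1, hne⟩
        obtain ⟨H, hH, hHG⟩ := ih _ (hn ▸ Finset.card_lt_card hss) G hG rfl
        exact ⟨H, hH, hHG.trans hss.subset⟩
  let f : Finset ℕ → X →L[ℝ] ℝ := fun F => if h : F ∈ 𝓕 then h.choose else 0
  have hf : ∀ F ∈ 𝓕, P F (f F) := fun F hF => by
    simp only [f, dif_pos hF]; exact hF.choose_spec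
  obtain ⟨φ, hφ, h⟩ := exists_subseq_matching_of_thin (isCompact_range_evaluations x)
    (by rintro _ ⟨g, _, rfl⟩; exact hx g) h𝓖 (f := fun F i => f F (x i))
    (fun F hF => ⟨f F, hP _ _ (hf F hF.1), rfl⟩) hε
  refine ⟨φ, hφ, fun F f₀ hf₀ => ?_⟩
  obtain ⟨G, hG, hGF⟩ := hmin _ (F.image φ) ⟨f₀, hf₀⟩ rfl
  obtain ⟨F', hF', rfl⟩ := Finset.subset_image_iff.1 hGF
  obtain ⟨_, ⟨g, hg, rfl⟩, hgf, hs⟩ := h _ hG (by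
    rw [Finset.coe_image]; exact Set.image_subset_range _ _)
  refine ⟨F', hF', g, hcongr _ _ _ (hf _ hG.1) hg hgf, fun s hsF => ?_⟩
  have := hs (s.image φ) (by rw [Finset.coe_image]; exact Set.image_subset_range _ _)
    ((Finset.disjoint_image hφ.injective).2 hsF)
  rwa [Finset.sum_image fun a _ b _ hab => hφ.injective hab] at this

/-! ### Near biorthogonality and Elton's theorem -/

/-- Each `xⱼ` is normed by a functional of norm one that is nearly zero on the other vectors. -/
def NearlyBiorthogonal (x : ℕ → X) (ε : ℝ) : Prop :=
  ∀ j, ∃ g : X →L[ℝ] ℝ, ‖g‖ ≤ 1 ∧ g (x j) = 1 ∧ ∀ s : Finset ℕ, j ∉ s → ∑ i ∈ s, |g (x i)| ≤ ε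

theorem NearlyBiorthogonal.comp {x : ℕ → X} {ε : ℝ} (h : NearlyBiorthogonal x ε) {φ : ℕ → ℕ}
    (hφ : StrictMono φ) : NearlyBiorthogonal (x ∘ φ) ε := by
  classical
  intro j
  obtain ⟨g, hg, hgj, hs⟩ := h (φ j)
  refine ⟨g, hg, hgj, fun s hjs => ?_⟩
  have := hs (s.image φ) (by simpa [hφ.injective.eq_iff] using hjs)
  rwa [Finset.sum_image fun a _ b _ hab => hφ.injective hab] at this

/-- Matching applied to singletons carrying a norming functional: the property excludes the empty
set, so passing to a subset loses nothing. -/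
theorem exists_subseq_nearlyBiorthogonal {x : ℕ → X} (hn : Normalized x) (hx : WeaklyNull x)
    {ε : ℝ} (hε : 0 < ε) : ∃ φ : ℕ → ℕ, StrictMono φ ∧ NearlyBiorthogonal (x ∘ φ) ε := by
  classical
  obtain ⟨φ, hφ, h⟩ := exists_subseq_matching hx
    (fun F f => ‖f‖ ≤ 1 ∧ ∃ i, F = {i} ∧ f (x i) = 1) (fun F f h => h.1)
    (by
      rintro F f g ⟨-, i, rfl, hi⟩ hg hfg
      exact ⟨hg, i, rfl, by rw [hfg i (Finset.mem_singleton_self i), hi]⟩) hε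
  refine ⟨φ, hφ, fun j => ?_⟩
  obtain ⟨f, hf, hfj⟩ := exists_dual_vector'' ℝ (x (φ j))
  rw [hn] at hfj
  obtain ⟨F', hF', g, ⟨hg, i, hi, hgi⟩, hs⟩ := h {j} f
    ⟨hf, φ j, Finset.image_singleton _ _, by simpa using hfj⟩
  have hF'' : F' = {j} := by
    rcases Finset.subset_singleton_iff.1 hF' with rfl | h1
    · simp at hi
    · exact h1
  subst hF''
  rw [Finset.image_singleton, Finset.singleton_inj] at hi
  exact ⟨g, hg, by rw [Function.comp_apply, hi, hgi],
    fun s hjs => hs s (Finset.disjoint_singleton_right.2 hjs)⟩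

theorem map_linearCombination_eq_sum (g : X →L[ℝ] ℝ) (x : ℕ → X) (a : ℕ →₀ ℝ) :
    g (Finsupp.linearCombination ℝ x a) = ∑ i ∈ a.support, a i * g (x i) := by
  rw [Finsupp.linearCombination_apply, Finsupp.sum, map_sum]
  simp

theorem apply_le_norm {g : X →L[ℝ] ℝ} (hg : ‖g‖ ≤ 1) (v : X) : |g v| ≤ ‖v‖ := by
  simpa using g.le_of_opNorm_le hg v

theorem exists_abs_eq_max (a : ℕ →₀ ℝ) : ∃ j, ∀ i, |a i| ≤ |a j| := by
  by_cases ha : a.support.Nonempty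
  · obtain ⟨j, _, hj⟩ := Finset.exists_max_image a.support (fun i => |a i|) ha
    refine ⟨j, fun i => ?_⟩
    by_cases hi : i ∈ a.support
    · exact hj i hi
    · simp [Finsupp.notMem_support_iff.1 hi]
  · rw [Finset.not_nonempty_iff_eq_empty, Finsupp.support_eq_empty] at ha
    exact ⟨0, by simp [ha]⟩

theorem abs_sum_mul_le {a : ℕ →₀ ℝ} {m D : ℝ} {h : ℕ → ℝ} {s : Finset ℕ} (hm : 0 ≤ m)
    (ha : ∀ i, |a i| ≤ m) (hs : ∑ i ∈ s, |h i| ≤ D) : |∑ i ∈ s, a i * h i| ≤ m * D :=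
  calc |∑ i ∈ s, a i * h i| ≤ ∑ i ∈ s, |a i * h i| := Finset.abs_sum_le_sum_abs _ _
    _ ≤ ∑ i ∈ s, m * |h i| := Finset.sum_le_sum fun i _ => by
      rw [abs_mul]; exact mul_le_mul_of_nonneg_right (ha i) (abs_nonneg _)
    _ ≤ m * D := by rw [← Finset.mul_sum]; exact mul_le_mul_of_nonneg_left hs hm

/-- A functional that is one at `xⱼ` and nearly zero elsewhere recovers a maximal coefficient. -/
theorem mul_abs_le_abs_apply {x : ℕ → X} {ε : ℝ} {g : X →L[ℝ] ℝ} {j : ℕ} (hgj : g (x j) = 1)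
    (hs : ∀ s : Finset ℕ, j ∉ s → ∑ i ∈ s, |g (x i)| ≤ ε) {a : ℕ →₀ ℝ}
    (hj : ∀ i, |a i| ≤ |a j|) :
    (1 - ε) * |a j| ≤ |g (Finsupp.linearCombination ℝ x a)| := by
  classical
  by_cases ha : j ∈ a.support
  · rw [map_linearCombination_eq_sum, ← Finset.add_sum_erase _ _ ha, hgj, mul_one]
    have h1 := abs_sum_mul_le (abs_nonneg _) hj (hs (a.support.erase j) (Finset.notMem_erase _ _))
    have h2 := abs_add_le (a j + ∑ i ∈ a.support.erase j, a i * g (x i))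
      (-∑ i ∈ a.support.erase j, a i * g (x i))
    rw [abs_neg, add_neg_cancel_right] at h2
    linarith
  · simp [Finsupp.notMem_support_iff.1 ha]

theorem NearlyBiorthogonal.abs_le {x : ℕ → X} {ε : ℝ} (h : NearlyBiorthogonal x ε) (hε : ε ≤ 1)
    (a : ℕ →₀ ℝ) (i : ℕ) : (1 - ε) * |a i| ≤ ‖Finsupp.linearCombination ℝ x a‖ := by
  obtain ⟨j, hj⟩ := exists_abs_eq_max a
  obtain ⟨g, hg, hgj, hs⟩ := h j
  calc (1 - ε) * |a i| ≤ (1 - ε) * |a j| := mul_le_mul_of_nonneg_left (hj i) (by linarith)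
    _ ≤ _ := mul_abs_le_abs_apply hgj hs hj
    _ ≤ _ := apply_le_norm hg _

/-- The inequality defining `LSeq'`. -/
def NearUnconditional' (x : ℕ → X) (δ C : ℝ) : Prop :=
  ∀ (a : ℕ →₀ ℝ) (E : Finset ℕ), (∀ i ∈ a.support, δ ≤ |a i|) →
    ‖Finsupp.linearCombination ℝ x a‖ ≤ 1 →
    ‖∑ i ∈ E, a i • x i‖ ≤ C * ‖Finsupp.linearCombination ℝ x a‖

theorem sum_smul_eq_sum_inter (x : ℕ → X) (a : ℕ →₀ ℝ) (E : Finset ℕ) :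
    ∑ i ∈ E, a i • x i = ∑ i ∈ E ∩ a.support, a i • x i := by
  refine (Finset.sum_subset Finset.inter_subset_left fun i hi h => ?_).symm
  have : a i = 0 := by simpa [hi] using h
  rw [this, zero_smul]

theorem sum_comp_eq_sum_mapDomain (x : ℕ → X) {φ : ℕ → ℕ} (hφ : StrictMono φ) (a : ℕ →₀ ℝ)
    (E : Finset ℕ) :
    ∑ i ∈ E, a i • (x ∘ φ) i = ∑ i ∈ E.image φ, a.mapDomain φ i • x i := by
  rw [Finset.sum_image fun a _ b _ hab => hφ.injective hab]
  simp [Finsupp.mapDomain_apply hφ.injective]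

theorem abs_mapDomain_ge {φ : ℕ → ℕ} (hφ : StrictMono φ) {a : ℕ →₀ ℝ} {δ : ℝ}
    (ha : ∀ i ∈ a.support, δ ≤ |a i|) : ∀ i ∈ (a.mapDomain φ).support, δ ≤ |a.mapDomain φ i| := by
  intro i hi
  classical
  rw [Finsupp.mapDomain_support_of_injective hφ.injective, Finset.mem_image] at hi
  obtain ⟨k, hk, rfl⟩ := hi
  rw [Finsupp.mapDomain_apply hφ.injective]
  exact ha k hk

theorem NearUnconditional'.comp {x : ℕ → X} {δ C : ℝ} (h : NearUnconditional' x δ C)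
    {φ : ℕ → ℕ} (hφ : StrictMono φ) : NearUnconditional' (x ∘ φ) δ C := by
  intro a E ha hn
  rw [← Finsupp.linearCombination_mapDomain] at hn ⊢
  rw [sum_comp_eq_sum_mapDomain x hφ]
  exact h _ _ (abs_mapDomain_ge hφ ha) hn

theorem norm_le_of_forall_functional {v : X} {r : ℝ} (h : ∀ f : X →L[ℝ] ℝ, ‖f‖ ≤ 1 → f v ≤ r) :
    ‖v‖ ≤ r := by
  obtain ⟨f, hf, hfv⟩ := exists_dual_vector'' ℝ v
  have := h f hf
  rw [hfv] at this
  simpa using this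

/-- Elton's theorem, in the form that every normalized weakly null sequence has a subsequence
with `LSeq'` finite at `δ`. -/
theorem exists_subseq_nearUnconditional' {x : ℕ → X} (hn : Normalized x) (hx : WeaklyNull x)
    {δ : ℝ} (hδ : 0 < δ) :
    ∃ φ : ℕ → ℕ, StrictMono φ ∧ NearUnconditional' (x ∘ φ) δ (16 / δ ^ 2) := by
  classical
  obtain ⟨φ₀, hφ₀, hb⟩ := exists_subseq_nearlyBiorthogonal hn hx (ε := 1 / 4) (by norm_num)
  obtain ⟨φ, hφ, h⟩ := exists_subseq_matching (hx.comp hφ₀)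
    (fun F f => ‖f‖ ≤ 1 ∧ (∀ i ∈ F, 0 ≤ f ((x ∘ φ₀) i)) ∧ 2 / δ ≤ ∑ i ∈ F, f ((x ∘ φ₀) i))
    (fun F f h => h.1)
    (by
      rintro F f g ⟨-, h1, h2⟩ hg hfg
      refine ⟨hg, fun i hi => ?_, ?_⟩
      · rw [hfg i hi]; exact h1 i hi
      · rwa [Finset.sum_congr rfl hfg]) (ε := 1 / 4) (by norm_num)
  refine ⟨φ₀ ∘ φ, hφ₀.comp hφ, ?_⟩
  set y := x ∘ φ₀ ∘ φ with hy
  have hby : NearlyBiorthogonal y (1 / 4) := hb.comp hφ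
  have hcoef : ∀ a : ℕ →₀ ℝ, ‖Finsupp.linearCombination ℝ y a‖ ≤ 1 → ∀ i, |a i| ≤ 2 := by
    intro a ha i
    have := hby.abs_le (by norm_num) a i
    linarith
  have key : ∀ a : ℕ →₀ ℝ, (∀ i ∈ a.support, δ ≤ |a i|) →
      ‖Finsupp.linearCombination ℝ y a‖ ≤ 1 → ∀ f : X →L[ℝ] ℝ, ‖f‖ ≤ 1 → ∀ E : Finset ℕ,
      (∀ i ∈ E, 0 < a i ∧ 0 ≤ f (y i)) → ∑ i ∈ E, a i * f (y i) ≤ 4 / δ := by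
    intro a ha hna f hf E hE
    -- Otherwise a matched `g` has mass at least `2 / δ` on some `F ⊆ E`, where the coefficients are
    -- at least `δ`, and mass at most `1 / 4` on the rest, where they are at most 2. Then `g` takes
    -- a value of at least `2 - 1 / 2 > 1` on a vector of norm at most 1.
    have hsum : ∑ i ∈ E, f (y i) ≤ 2 / δ := by
      by_contra hcon
      obtain ⟨F, hFE, g, ⟨hg, hg0, hgs⟩, hs⟩ := h E f ⟨hf, by
        intro i hi
        obtain ⟨k, hk, rfl⟩ := Finset.mem_image.1 hi
        exact (hE k hk).2, by
        rw [Finset.sum_image fun a _ b _ hab => hφ.injective hab]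
        exact (not_le.1 hcon).le⟩
      rw [Finset.sum_image fun a _ b _ hab => hφ.injective hab] at hgs
      have hFs : F ⊆ a.support := fun i hi => Finsupp.mem_support_iff.2 (hE i (hFE hi)).1.ne'
      have h1 : ∑ i ∈ F, δ * g (y i) ≤ ∑ i ∈ F, a i * g (y i) :=
        Finset.sum_le_sum fun i hi => by
          refine mul_le_mul_of_nonneg_right ?_ (hg0 _ (Finset.mem_image_of_mem _ hi))
          have := ha i (hFs hi)
          rwa [abs_of_pos (hE i (hFE hi)).1] at this
      have h2 := abs_sum_mul_le (h := fun i => g (y i)) (by norm_num) (hcoef a hna)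
        (hs (a.support \ F) Finset.sdiff_disjoint)
      have h3 := (le_abs_self _).trans ((apply_le_norm hg _).trans hna)
      rw [map_linearCombination_eq_sum, ← Finset.sum_sdiff hFs] at h3
      rw [← Finset.mul_sum] at h1
      have h4 : 2 ≤ δ * ∑ i ∈ F, g (y i) := by
        have := mul_le_mul_of_nonneg_left hgs hδ.le
        rwa [mul_div_cancel₀ _ hδ.ne'] at this
      have h5 := (abs_le.1 h2).1
      linarith
    calc ∑ i ∈ E, a i * f (y i) ≤ ∑ i ∈ E, 2 * f (y i) := Finset.sum_le_sum fun i hi =>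
          mul_le_mul_of_nonneg_right ((le_abs_self _).trans (hcoef a hna i)) (hE i hi).2
      _ ≤ 2 * (2 / δ) := by rw [← Finset.mul_sum]; linarith
      _ = 4 / δ := by ring
  intro a E ha hna
  by_cases ha0 : a.support.Nonempty
  swap
  · rw [Finset.not_nonempty_iff_eq_empty, Finsupp.support_eq_empty] at ha0
    simp [ha0]
  obtain ⟨j, hj⟩ := ha0
  have hlow : δ / 2 ≤ ‖Finsupp.linearCombination ℝ y a‖ := by
    have := hby.abs_le (by norm_num) a j
    have := ha j hj
    linarith
  have hup : ‖∑ i ∈ E, a i • y i‖ ≤ 8 / δ := by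
    refine norm_le_of_forall_functional fun f hf => ?_
    have h1 := key a ha hna f hf (E.filter fun i => 0 < a i ∧ 0 ≤ f (y i))
      fun i hi => (Finset.mem_filter.1 hi).2
    have h2 := key (-a) (by simpa using ha) (by simpa using hna) (-f) (by simpa using hf)
      (E.filter fun i => 0 < -a i ∧ 0 ≤ -f (y i)) fun i hi => by
        simpa using (Finset.mem_filter.1 hi).2
    rw [Finset.sum_filter] at h1 h2
    -- Only indices where coefficient and functional have equal signs contribute positively; the
    -- negative pair reduces to the positive one by replacing `a` and `f` with their negatives.
    have h3 : f (∑ i ∈ E, a i • y i) ≤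
        ∑ i ∈ E, ((if 0 < a i ∧ 0 ≤ f (y i) then a i * f (y i) else 0) +
          if 0 < -a i ∧ 0 ≤ -f (y i) then (-a) i * (-f) (y i) else 0) := by
      rw [map_sum]
      refine Finset.sum_le_sum fun i _ => ?_
      simp only [map_smul, smul_eq_mul, Finsupp.coe_neg, Pi.neg_apply,
        neg_apply, neg_mul_neg]
      rcases lt_trichotomy (a i) 0 with h | h | h
      · rcases le_total 0 (f (y i)) with h' | h'
        · have : a i * f (y i) ≤ 0 := mul_nonpos_of_nonpos_of_nonneg h.le h'
          split_ifs <;> linarith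
        · rw [if_neg (by intro h1; linarith [h1.1]), if_pos (by constructor <;> linarith)]
          linarith
      · simp [h]
      · rcases le_total 0 (f (y i)) with h' | h'
        · rw [if_pos ⟨h, h'⟩, if_neg (by intro h1; linarith [h1.1])]
          linarith
        · have : a i * f (y i) ≤ 0 := mul_nonpos_of_nonneg_of_nonpos h.le h'
          split_ifs <;> linarith
    rw [Finset.sum_add_distrib] at h3
    calc _ ≤ _ := h3
      _ ≤ 4 / δ + 4 / δ := add_le_add h1 h2
      _ = 8 / δ := by ring
  calc _ ≤ 8 / δ := hup
    _ = 16 / δ ^ 2 * (δ / 2) := by field_simp; norm_num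
    _ ≤ _ := mul_le_mul_of_nonneg_left hlow (by positivity)

end

/-! ### The norm of c₀ and the renorming -/

theorem linearCombination_c0Basis_apply (a : ℕ →₀ ℝ) (i : ℕ) :
    Finsupp.linearCombination ℝ c0Basis a i = a i := by
  have hc : ∀ n, (c0Basis n) i = Pi.single (M := fun _ => ℝ) n 1 i := fun n => rfl
  induction a using Finsupp.induction_linear with
  | zero => simp
  | add f g hf hg => rw [map_add, ZeroAtInftyContinuousMap.add_apply, hf, hg, Finsupp.add_apply]
  | single n r =>
    rw [Finsupp.linearCombination_single, ZeroAtInftyContinuousMap.smul_apply, hc,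
      Finsupp.single_apply, Pi.single_apply]
    by_cases h : n = i
    · simp [h]
    · simp [h, Ne.symm h]

theorem norm_linearCombination_c0Basis_le {a : ℕ →₀ ℝ} {r : ℝ} (h : ∀ i, |a i| ≤ r) :
    ‖Finsupp.linearCombination ℝ c0Basis a‖ ≤ r := by
  rw [← ZeroAtInftyContinuousMap.norm_toBCF_eq_norm,
    BoundedContinuousFunction.norm_le ((abs_nonneg _).trans (h 0))]
  intro i
  rw [ZeroAtInftyContinuousMap.toBCF_apply, linearCombination_c0Basis_apply]
  exact h i

theorem abs_le_norm_linearCombination_c0Basis (a : ℕ →₀ ℝ) (i : ℕ) :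
    |a i| ≤ ‖Finsupp.linearCombination ℝ c0Basis a‖ := by
  rw [← ZeroAtInftyContinuousMap.norm_toBCF_eq_norm]
  have := (Finsupp.linearCombination ℝ c0Basis a).toBCF.norm_coe_le_norm i
  rwa [ZeroAtInftyContinuousMap.toBCF_apply, linearCombination_c0Basis_apply] at this

section
variable {X : Type u} [NormedAddCommGroup X] [NormedSpace ℝ X]

/-- Evaluation of vectors at the members of a set of functionals of norm at most one. -/
noncomputable def evalLp (W : Set (X →L[ℝ] ℝ)) (hW : ∀ w ∈ W, ‖w‖ ≤ 1) :
    X →ₗ[ℝ] lp (fun _ : W => ℝ) ∞ where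
  toFun v := ⟨fun w => w.1 v, memℓp_infty ⟨‖v‖, by
    rintro _ ⟨w, rfl⟩
    exact apply_le_norm (hW w.1 w.2) v⟩⟩
  map_add' u v := by ext w; exact map_add w.1 u v
  map_smul' r v := by ext w; exact map_smul w.1 r v

theorem norm_evalLp_le {W : Set (X →L[ℝ] ℝ)} (hW : ∀ w ∈ W, ‖w‖ ≤ 1) {v : X} {r : ℝ}
    (hr : 0 ≤ r) (h : ∀ w ∈ W, |w v| ≤ r) : ‖evalLp W hW v‖ ≤ r :=
  lp.norm_le_of_forall_le hr fun w => h w.1 w.2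

theorem abs_apply_le_norm_evalLp {W : Set (X →L[ℝ] ℝ)} (hW : ∀ w ∈ W, ‖w‖ ≤ 1) {w : X →L[ℝ] ℝ}
    (hw : w ∈ W) (v : X) : |w v| ≤ ‖evalLp W hW v‖ :=
  lp.norm_apply_le_norm ENNReal.top_ne_zero (evalLp W hW v) ⟨w, hw⟩

/-- The suppression inequality bounds every partial sum of `a i * f (x i)` by `Λ`. Summing the
nonnegative and the negative terms separately costs the factor 2, and `|a i| ≥ δ` allows division by
`δ`. -/
theorem sum_abs_apply_le_of_nearUnconditional' {x : ℕ → X} {δ Λ : ℝ} (hδ : 0 < δ) (hΛ : 0 ≤ Λ)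
    (hx : NearUnconditional' x δ Λ) {a : ℕ →₀ ℝ} (ha : ∀ i ∈ a.support, δ ≤ |a i|)
    (hna : ‖Finsupp.linearCombination ℝ x a‖ ≤ 1) {f : X →L[ℝ] ℝ} (hf : ‖f‖ ≤ 1) :
    ∑ i ∈ a.support, |f (x i)| ≤ 2 * Λ / δ := by
  have key : ∀ E : Finset ℕ, |∑ i ∈ E, a i * f (x i)| ≤ Λ := fun E => by
    have h1 := (apply_le_norm hf (∑ i ∈ E, a i • x i)).trans (hx a E ha hna)
    rw [map_sum] at h1
    simp only [map_smul, smul_eq_mul] at h1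
    exact h1.trans (mul_le_of_le_one_right hΛ hna)
  rw [le_div_iff₀ hδ, Finset.sum_mul]
  calc ∑ i ∈ a.support, |f (x i)| * δ ≤ ∑ i ∈ a.support, |a i * f (x i)| :=
        Finset.sum_le_sum fun i hi => by
          rw [abs_mul, mul_comm]
          exact mul_le_mul_of_nonneg_right (ha i hi) (abs_nonneg _)
    _ = ∑ i ∈ a.support with 0 ≤ a i * f (x i), a i * f (x i) -
        ∑ i ∈ a.support with ¬ 0 ≤ a i * f (x i), a i * f (x i) := by
      rw [← Finset.sum_filter_add_sum_filter_not a.support fun i => 0 ≤ a i * f (x i),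
        sub_eq_add_neg, ← Finset.sum_neg_distrib]
      congr 1
      · exact Finset.sum_congr rfl fun i hi => abs_of_nonneg (Finset.mem_filter.1 hi).2
      · exact Finset.sum_congr rfl fun i hi =>
          abs_of_neg (not_le.1 (Finset.mem_filter.1 hi).2)
    _ ≤ 2 * Λ := by
      have h1 := (abs_le.1 (key {i ∈ a.support | 0 ≤ a i * f (x i)})).2
      have h2 := (abs_le.1 (key {i ∈ a.support | ¬ 0 ≤ a i * f (x i)})).1
      linarith

/-- A weakly null sequence with no subsequence satisfying `NearUnconditional'` with constant `c`
gives rise to a sequence equivalent to the basis of `c₀` with no unconditional subsequence with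
constant `c`. -/
theorem exists_equivalentWith_c0Basis {x : ℕ → X} (hn : Normalized x) (hx : WeaklyNull x)
    {δ Λ T c : ℝ} (hδ : 0 < δ) (hδ1 : δ ≤ 1) (hΛ : NearUnconditional' x δ Λ) (hc : 0 ≤ c)
    (hT : 2 * Λ / δ < T) (hbad : ∀ φ : ℕ → ℕ, StrictMono φ → ¬ NearUnconditional' (x ∘ φ) δ c) :
    ∃ (Y : Type u) (_ : NormedAddCommGroup Y) (_ : NormedSpace ℝ Y) (_ : CompleteSpace Y)
      (y : ℕ → Y), Normalized y ∧ EquivalentWith T c0Basis y ∧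
      ∀ ψ : ℕ → ℕ, StrictMono ψ → ¬ UnconditionalWith c (y ∘ ψ) := by
  classical
  have hΛ1 : 1 ≤ Λ := by
    have h1 := hΛ (Finsupp.single 0 1) {0} (by
      intro i hi
      have hi := Finset.mem_singleton.1 (Finsupp.support_single_subset hi)
      simpa [hi] using hδ1) (by simp [hn 0])
    simpa [hn 0] using h1
  set S := 2 * Λ / δ with hS
  have hS1 : 1 ≤ S := by rw [hS, le_div_iff₀ hδ]; linarith
  -- Chosen so that `(S + ε) / (1 - ε) = T`, the quotient of the two equivalence constants obtained
  -- below.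
  set ε := (T - S) / (1 + T) with hε
  have hε0 : 0 < ε := div_pos (by linarith) (by linarith)
  have hε1 : ε < 1 := by rw [hε, div_lt_one (by linarith)]; linarith
  have hD : S + ε = T * (1 - ε) := by
    have : ε * (1 + T) = T - S := div_mul_cancel₀ _ (by linarith)
    linarith
  obtain ⟨φ₀, hφ₀, hb₀⟩ := exists_subseq_nearlyBiorthogonal hn hx hε0
  obtain ⟨φ, hφ, h⟩ := exists_subseq_matching (hx.comp hφ₀)
    (fun F f => ‖f‖ ≤ 1 ∧ ∃ (a : ℕ →₀ ℝ) (E : Finset ℕ), a.support = F ∧ E ⊆ F ∧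
      (∀ i ∈ a.support, δ ≤ |a i|) ∧ ‖Finsupp.linearCombination ℝ (x ∘ φ₀) a‖ ≤ 1 ∧
      c * ‖Finsupp.linearCombination ℝ (x ∘ φ₀) a‖ < f (∑ i ∈ E, a i • (x ∘ φ₀) i))
    (fun F f h => h.1)
    (by
      rintro F f g ⟨-, a, E, haF, hEF, ha, hna, hlt⟩ hg hfg
      refine ⟨hg, a, E, haF, hEF, ha, hna, hlt.trans_eq ?_⟩
      simp only [map_sum, map_smul]
      exact Finset.sum_congr rfl fun i hi => by rw [hfg i (hEF hi)]) hε0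
  have hΛ₀ := hΛ.comp hφ₀
  have hbad₀ : ∀ ψ : ℕ → ℕ, StrictMono ψ → ¬ NearUnconditional' ((x ∘ φ₀) ∘ ψ) δ c :=
    fun ψ hψ => hbad _ (hφ₀.comp hψ)
  have hn₀ := hn.comp φ₀
  generalize x ∘ φ₀ = z at h hΛ₀ hbad₀ hn₀ hb₀
  have hb := hb₀.comp hφ
  -- The norming set of the new norm. The mass bound gives the upper c₀-estimate; the biorthogonal
  -- functionals belong to `W` because `1 ≤ S`, and give the lower one.
  let W : Set (X →L[ℝ] ℝ) :=
    {g | ‖g‖ ≤ 1 ∧ ∀ s : Finset ℕ, ∑ i ∈ s, |g ((z ∘ φ) i)| ≤ S + ε}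
  have hW : ∀ w ∈ W, ‖w‖ ≤ 1 := fun w hw => hw.1
  have hbW : ∀ j, ∃ g ∈ W, g ((z ∘ φ) j) = 1 ∧
      ∀ s : Finset ℕ, j ∉ s → ∑ i ∈ s, |g ((z ∘ φ) i)| ≤ ε := by
    intro j
    obtain ⟨g, hg, hgj, hs⟩ := hb j
    refine ⟨g, ⟨hg, fun s => ?_⟩, hgj, hs⟩
    calc ∑ i ∈ s, |g ((z ∘ φ) i)| ≤ ∑ i ∈ insert j (s.erase j), |g ((z ∘ φ) i)| :=
          Finset.sum_le_sum_of_subset_of_nonneg (fun i hi => by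
            by_cases hij : i = j <;> simp [hij, hi]) fun _ _ _ => abs_nonneg _
      _ ≤ 1 + ε := by
        rw [Finset.sum_insert (Finset.notMem_erase _ _), hgj, abs_one]
        linarith [hs (s.erase j) (Finset.notMem_erase _ _)]
      _ ≤ S + ε := by linarith
  have hle : ∀ v, ‖evalLp W hW v‖ ≤ ‖v‖ := fun v =>
    norm_evalLp_le hW (norm_nonneg v) fun w hw => apply_le_norm hw.1 v
  have hlc : ∀ (θ : ℕ → ℕ) (a : ℕ →₀ ℝ),
      Finsupp.linearCombination ℝ ((fun j => evalLp W hW ((z ∘ φ) j)) ∘ θ) a =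
      evalLp W hW (Finsupp.linearCombination ℝ ((z ∘ φ) ∘ θ) a) := fun θ a => by
    rw [Finsupp.apply_linearCombination]; rfl
  refine ⟨lp (fun _ : W => ℝ) ∞, inferInstance, inferInstance, inferInstance,
    fun j => evalLp W hW ((z ∘ φ) j), fun j => ?_, ⟨1 - ε, S + ε, by linarith, by linarith,
      ?_, fun a => ⟨?_, ?_⟩⟩, fun ψ hψ hu => ?_⟩
  · refine le_antisymm ((hle _).trans (hn₀ _).le) ?_
    obtain ⟨g, hg, hgj, -⟩ := hbW j
    have := abs_apply_le_norm_evalLp hW hg ((z ∘ φ) j)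
    rwa [hgj, abs_one] at this
  · rw [hD, mul_div_cancel_right₀ _ (by linarith)]
  · obtain ⟨j, hj⟩ := exists_abs_eq_max a
    obtain ⟨g, hg, hgj, hs⟩ := hbW j
    calc (1 - ε) * ‖Finsupp.linearCombination ℝ c0Basis a‖ ≤ (1 - ε) * |a j| :=
          mul_le_mul_of_nonneg_left (norm_linearCombination_c0Basis_le hj) (by linarith)
      _ ≤ _ := mul_abs_le_abs_apply hgj hs hj
      _ ≤ _ := abs_apply_le_norm_evalLp hW hg _
      _ = _ := congrArg norm (hlc id a).symm
  · have := hlc id a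
    simp only [Function.comp_id] at this
    rw [this]
    refine norm_evalLp_le hW (by positivity) fun w hw => ?_
    rw [map_linearCombination_eq_sum, mul_comm]
    exact abs_sum_mul_le (norm_nonneg _) (abs_le_norm_linearCombination_c0Basis a)
      (hw.2 a.support)
  · have h1 := hbad₀ (φ ∘ ψ) (hφ.comp hψ)
    -- A failure of suppression along `φ ∘ ψ` is matched to a failure `b`, `E'` on a smaller
    -- support, witnessed by `g ∈ W`. The new norm dominates `g` and is dominated by the old norm,
    -- so the failure persists in the new norm.
    simp only [NearUnconditional', not_forall, not_le] at h1
    obtain ⟨a, E, ha, hna, hlt⟩ := h1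
    obtain ⟨f, hf, hfv⟩ := exists_dual_vector'' ℝ (∑ i ∈ E, a i • (z ∘ φ ∘ ψ) i)
    have hθ := hφ.comp hψ
    rw [← Finsupp.linearCombination_mapDomain] at hna hlt
    obtain ⟨F', hF', g, ⟨hg, b, E', hbF, hEF, hbδ, hnb, hltb⟩, hs⟩ :=
      h (a.support.image ψ) f ⟨hf, a.mapDomain (φ ∘ ψ), (E ∩ a.support).image (φ ∘ ψ), by
        rw [Finsupp.mapDomain_support_of_injective hθ.injective, Finset.image_image], by
        rw [Finset.image_image]
        exact Finset.image_subset_image Finset.inter_subset_right, abs_mapDomain_ge hθ ha, hna, by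
        rw [← sum_comp_eq_sum_mapDomain z hθ, ← sum_smul_eq_sum_inter, hfv]
        exact hlt⟩
    have hgW : g ∈ W := by
      refine ⟨hg, fun s => ?_⟩
      have h2 := sum_abs_apply_le_of_nearUnconditional' hδ (by linarith) hΛ₀ hbδ hnb hg
      rw [hbF, Finset.sum_image fun a _ b _ hab => hφ.injective hab] at h2
      calc ∑ i ∈ s, |g ((z ∘ φ) i)| ≤ ∑ i ∈ F' ∪ s \ F', |g ((z ∘ φ) i)| :=
            Finset.sum_le_sum_of_subset_of_nonneg (by simp) fun _ _ _ => abs_nonneg _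
        _ ≤ S + ε := by
          rw [Finset.sum_union Finset.disjoint_sdiff]
          exact add_le_add h2 (hs _ Finset.sdiff_disjoint)
    obtain ⟨G, hG, rfl⟩ := Finset.subset_image_iff.1 hF'
    rw [Finset.image_image] at hbF hEF
    obtain ⟨d, rfl⟩ : ∃ d : ℕ →₀ ℝ, b = d.mapDomain (φ ∘ ψ) := by
      refine ⟨b.comapDomain (φ ∘ ψ) hθ.injective.injOn, ?_⟩
      rw [Finsupp.mapDomain_comapDomain _ hθ.injective]
      rw [hbF, Finset.coe_image]
      exact Set.image_subset_range _ _
    obtain ⟨E'', -, rfl⟩ := Finset.subset_image_iff.1 hEF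
    rw [← sum_comp_eq_sum_mapDomain z hθ, Finsupp.linearCombination_mapDomain] at hltb
    have h3 := hu.2 d E''
    rw [hlc ψ d] at h3
    have h4 : ∑ i ∈ E'', d i • ((fun j => evalLp W hW ((z ∘ φ) j)) ∘ ψ) i =
        evalLp W hW (∑ i ∈ E'', d i • (z ∘ φ ∘ ψ) i) := by
      rw [map_sum]; simp
    rw [h4] at h3
    have h5 := (le_abs_self _).trans (abs_apply_le_norm_evalLp hW hgW
      (∑ i ∈ E'', d i • (z ∘ φ ∘ ψ) i))
    have h6 := mul_le_mul_of_nonneg_left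
      (hle (Finsupp.linearCombination ℝ ((z ∘ φ) ∘ ψ) d)) hc
    exact absurd (hltb.trans_le (h5.trans (h3.trans h6))) (lt_irrefl _)

end

/-! ### Large and small coefficients -/

section
variable {X : Type u} [NormedAddCommGroup X] [NormedSpace ℝ X]

/-- The inequality defining `LSeq`. -/
def NearUnconditional (x : ℕ → X) (δ C : ℝ) : Prop :=
  ∀ (a : ℕ →₀ ℝ) (E : Finset ℕ), (∀ i ∈ a.support, δ ≤ |a i|) → (∀ i, |a i| ≤ 1) →
    ‖∑ i ∈ E, a i • x i‖ ≤ C * ‖Finsupp.linearCombination ℝ x a‖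

theorem LSeq_le {x : ℕ → X} {δ : ℝ} {c : ℝ≥0} (h : NearUnconditional x δ c) : LSeq x δ ≤ c :=
  iInf₂_le c h

theorem LSeq'_le {x : ℕ → X} {δ : ℝ} {c : ℝ≥0} (h : NearUnconditional' x δ c) : LSeq' x δ ≤ c :=
  iInf₂_le c h

theorem exists_of_LSeq_lt {x : ℕ → X} {δ : ℝ} {r : ℝ≥0∞} (h : LSeq x δ < r) :
    ∃ c : ℝ≥0, (c : ℝ≥0∞) < r ∧ NearUnconditional x δ c := by
  simp only [LSeq, iInf_lt_iff] at h
  obtain ⟨c, hc, hr⟩ := h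
  exact ⟨c, hr, hc⟩

theorem exists_of_LSeq'_lt {x : ℕ → X} {δ : ℝ} {r : ℝ≥0∞} (h : LSeq' x δ < r) :
    ∃ c : ℝ≥0, (c : ℝ≥0∞) < r ∧ NearUnconditional' x δ c := by
  simp only [LSeq', iInf_lt_iff] at h
  obtain ⟨c, hc, hr⟩ := h
  exact ⟨c, hr, hc⟩

theorem NearUnconditional.mono {x : ℕ → X} {δ c d : ℝ} (h : NearUnconditional x δ c)
    (hcd : c ≤ d) : NearUnconditional x δ d := fun a E h1 h2 =>
  (h a E h1 h2).trans (mul_le_mul_of_nonneg_right hcd (norm_nonneg _))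

theorem NearUnconditional'.mono {x : ℕ → X} {δ c d : ℝ} (h : NearUnconditional' x δ c)
    (hcd : c ≤ d) : NearUnconditional' x δ d := fun a E h1 h2 =>
  (h a E h1 h2).trans (mul_le_mul_of_nonneg_right hcd (norm_nonneg _))

theorem UnconditionalWith.mono {x : ℕ → X} {c d : ℝ} (h : UnconditionalWith c x)
    (hcd : c ≤ d) : UnconditionalWith d x := ⟨h.1, fun a E =>
  (h.2 a E).trans (mul_le_mul_of_nonneg_right hcd (norm_nonneg _))⟩

theorem exists_subseq_of_L_lt [CompleteSpace X] {x : ℕ → X} (hn : Normalized x)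
    (hx : WeaklyNull x) {δ : ℝ} {r : ℝ≥0} (h : L.{u} δ < r) :
    ∃ φ : ℕ → ℕ, StrictMono φ ∧ NearUnconditional (x ∘ φ) δ r := by
  have h1 : (⨅ (φ : ℕ → ℕ) (_ : StrictMono φ), LSeq (x ∘ φ) δ) < r := by
    refine lt_of_le_of_lt ?_ h
    refine le_iSup_of_le X <| le_iSup_of_le inferInstance <| le_iSup_of_le inferInstance <|
      le_iSup_of_le inferInstance <| le_iSup_of_le x <| le_iSup_of_le hn <| le_iSup_of_le hx le_rfl
  simp only [iInf_lt_iff] at h1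
  obtain ⟨φ, hφ, h1⟩ := h1
  obtain ⟨c, hc, h2⟩ := exists_of_LSeq_lt h1
  exact ⟨φ, hφ, h2.mono (by exact_mod_cast hc.le)⟩

theorem exists_subseq_of_L'_lt [CompleteSpace X] {x : ℕ → X} (hn : Normalized x)
    (hx : WeaklyNull x) {δ : ℝ} {r : ℝ≥0∞} (h : L'.{u} δ < r) :
    ∃ φ : ℕ → ℕ, StrictMono φ ∧ ∃ c : ℝ≥0, (c : ℝ≥0∞) < r ∧ NearUnconditional' (x ∘ φ) δ c := by
  have h1 : (⨅ (φ : ℕ → ℕ) (_ : StrictMono φ), LSeq' (x ∘ φ) δ) < r := by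
    refine lt_of_le_of_lt ?_ h
    refine le_iSup_of_le X <| le_iSup_of_le inferInstance <| le_iSup_of_le inferInstance <|
      le_iSup_of_le inferInstance <| le_iSup_of_le x <| le_iSup_of_le hn <| le_iSup_of_le hx le_rfl
  simp only [iInf_lt_iff] at h1
  obtain ⟨φ, hφ, h1⟩ := h1
  exact ⟨φ, hφ, exists_of_LSeq'_lt h1⟩

theorem sum_eq_linearCombination_filter (x : ℕ → X) (a : ℕ →₀ ℝ) (E : Finset ℕ) :
    ∑ i ∈ E, a i • x i = Finsupp.linearCombination ℝ x (a.filter (· ∈ E)) := by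
  rw [Finsupp.linearCombination_apply, Finsupp.sum, Finsupp.support_filter,
    sum_smul_eq_sum_inter, Finset.inter_comm, Finset.filter_mem_eq_inter]
  refine Finset.sum_congr rfl fun i hi => ?_
  rw [Finsupp.filter_apply_pos _ _ (Finset.mem_inter.1 hi).2]

theorem norm_linearCombination_c0Basis_mapDomain {φ : ℕ → ℕ} (hφ : StrictMono φ) (a : ℕ →₀ ℝ) :
    ‖Finsupp.linearCombination ℝ c0Basis (a.mapDomain φ)‖ =
      ‖Finsupp.linearCombination ℝ c0Basis a‖ := by
  refine le_antisymm (norm_linearCombination_c0Basis_le fun i => ?_)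
    (norm_linearCombination_c0Basis_le fun i => ?_)
  · by_cases hi : i ∈ Set.range φ
    · obtain ⟨k, rfl⟩ := hi
      rw [Finsupp.mapDomain_apply hφ.injective]
      exact abs_le_norm_linearCombination_c0Basis a k
    · rw [Finsupp.mapDomain_of_notMem_range _ _ hi, abs_zero]
      exact norm_nonneg _
  · rw [← Finsupp.mapDomain_apply hφ.injective a i]
    exact abs_le_norm_linearCombination_c0Basis _ _

theorem EquivalentWith.comp {K : ℝ} {x : ℕ → X} (h : EquivalentWith K c0Basis x) {φ : ℕ → ℕ}
    (hφ : StrictMono φ) : EquivalentWith K c0Basis (x ∘ φ) := by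
  obtain ⟨A, B, hA, hB, hK, hAB⟩ := h
  refine ⟨A, B, hA, hB, hK, fun a => ?_⟩
  rw [← Finsupp.linearCombination_mapDomain, ← norm_linearCombination_c0Basis_mapDomain hφ]
  exact hAB _

/-- Testing a functional on sign combinations, whose norms are uniformly bounded, shows that its
values along the sequence are absolutely summable. -/
theorem EquivalentWith.weaklyNull {K : ℝ} {x : ℕ → X} (h : EquivalentWith K c0Basis x) :
    WeaklyNull x := by
  obtain ⟨A, B, hA, hB, -, hAB⟩ := h
  intro f
  have hsum : ∀ s : Finset ℕ, ∑ i ∈ s, |f (x i)| ≤ ‖f‖ * (B * 1) := by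
    intro s
    let a : ℕ →₀ ℝ := Finsupp.indicator s fun i _ => (SignType.sign (f (x i)) : ℝ)
    have ha : ∀ i, |a i| ≤ 1 := fun i => by
      by_cases hi : i ∈ s
      · rw [Finsupp.indicator_of_mem hi]
        rcases lt_trichotomy (f (x i)) 0 with h | h | h <;> simp [h]
      · rw [Finsupp.indicator_of_notMem hi]; simp
    calc ∑ i ∈ s, |f (x i)| = ∑ i ∈ s, a i * f (x i) := Finset.sum_congr rfl fun i hi => by
          rw [Finsupp.indicator_of_mem hi, sign_mul_self]
      _ = f (Finsupp.linearCombination ℝ x a) := by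
        rw [map_linearCombination_eq_sum]
        refine (Finset.sum_subset (Finsupp.support_indicator_subset s _) fun i _ hi => ?_).symm
        rw [Finsupp.notMem_support_iff.1 hi, zero_mul]
      _ ≤ ‖f‖ * ‖Finsupp.linearCombination ℝ x a‖ := (le_abs_self _).trans (f.le_opNorm _)
      _ ≤ _ := mul_le_mul_of_nonneg_left ((hAB a).2.trans
        (mul_le_mul_of_nonneg_left (norm_linearCombination_c0Basis_le ha) hB.le)) (norm_nonneg _)
  have := (summable_of_sum_le (fun i => abs_nonneg (f (x i))) hsum).tendsto_atTop_zero
  exact (tendsto_zero_iff_abs_tendsto_zero _).2 this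

theorem sum_filter_add_sum_filter_neg (x : ℕ → X) (a : ℕ →₀ ℝ) (p : ℕ → Prop) [DecidablePred p]
    (E : Finset ℕ) : ∑ i ∈ E, a i • x i =
      ∑ i ∈ E, a.filter p i • x i + ∑ i ∈ E, a.filter (¬ p ·) i • x i := by
  rw [← Finset.sum_add_distrib]
  refine Finset.sum_congr rfl fun i _ => ?_
  rw [← add_smul, ← Finsupp.add_apply, Finsupp.filter_add_filter_not]

theorem linearCombination_eq_filter_add (x : ℕ → X) (a : ℕ →₀ ℝ) (p : ℕ → Prop)
    [DecidablePred p] : Finsupp.linearCombination ℝ x a =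
      Finsupp.linearCombination ℝ x (a.filter p) +
        Finsupp.linearCombination ℝ x (a.filter (¬ p ·)) := by
  rw [← map_add, Finsupp.filter_add_filter_not]

theorem abs_filter_le {a : ℕ →₀ ℝ} {r : ℝ} (hr : 0 ≤ r) (p : ℕ → Prop) [DecidablePred p]
    (h : ∀ i, p i → |a i| ≤ r) (i : ℕ) : |a.filter p i| ≤ r := by
  rw [Finsupp.filter_apply]
  split_ifs with hi
  · exact h i hi
  · simpa using hr

/-- The suppression inequality for one vector follows from the one for a scalar multiple. -/
theorem norm_sum_le_of_smul {x : ℕ → X} {a : ℕ →₀ ℝ} {E : Finset ℕ} {c r : ℝ} (hr : 0 < r)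
    (h : ‖∑ i ∈ E, (r • a) i • x i‖ ≤ c * ‖Finsupp.linearCombination ℝ x (r • a)‖) :
    ‖∑ i ∈ E, a i • x i‖ ≤ c * ‖Finsupp.linearCombination ℝ x a‖ := by
  have h1 : ∑ i ∈ E, (r • a) i • x i = r • ∑ i ∈ E, a i • x i := by
    rw [Finset.smul_sum]
    exact Finset.sum_congr rfl fun i _ => by rw [Finsupp.smul_apply, smul_assoc]
  rw [h1, map_smul, norm_smul, norm_smul, Real.norm_of_nonneg hr.le, mul_left_comm] at h
  exact le_of_mul_le_mul_left h hr

/-- Scale the largest coefficient to 1, so that the vector has norm at least `A`, and cut at height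
`δ₁`. The small part and its projections have norm at most `B * δ₁`, which `B / A ≤ 1 / δ` turns
into `δ₁ / δ` times the norm of the vector. -/
theorem EquivalentWith.unconditionalWith {x : ℕ → X} {δ δ₁ c : ℝ} (hδ : 0 < δ) (hδ₁ : 0 < δ₁)
    (h : EquivalentWith (1 / δ) c0Basis x) (hn : Normalized x)
    (hc : 0 ≤ c) (hx : NearUnconditional x δ₁ c) :
    UnconditionalWith (c * (1 + δ₁ / δ) + δ₁ / δ) x := by
  classical
  obtain ⟨A, B, hA, hB, hK, hAB⟩ := h
  refine ⟨fun i hi => by simpa [hi] using hn i, fun a E => ?_⟩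
  have hup : ∀ (b : ℕ →₀ ℝ) (r : ℝ), (∀ i, |b i| ≤ r) →
      ‖Finsupp.linearCombination ℝ x b‖ ≤ B * r := fun b r hb =>
    (hAB b).2.trans (mul_le_mul_of_nonneg_left (norm_linearCombination_c0Basis_le hb) hB.le)
  obtain ⟨j, hj⟩ := exists_abs_eq_max a
  rcases (abs_nonneg (a j)).eq_or_lt with h0 | h0
  · have : a = 0 := by
      ext i
      exact abs_eq_zero.1 (le_antisymm ((hj i).trans h0.ge) (abs_nonneg _))
    simp [this]
  refine norm_sum_le_of_smul (inv_pos.2 h0) ?_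
  have hb1 : ∀ i, |(|a j|⁻¹ • a) i| ≤ 1 := fun i => by
    rw [Finsupp.smul_apply, smul_eq_mul, abs_mul, abs_inv, abs_abs, inv_mul_le_one₀ h0]
    exact hj i
  have hbj : |(|a j|⁻¹ • a) j| = 1 := by
    rw [Finsupp.smul_apply, smul_eq_mul, abs_mul, abs_inv, abs_abs, inv_mul_cancel₀ h0.ne']
  generalize |a j|⁻¹ • a = b at hb1 hbj
  have hAle : A ≤ ‖Finsupp.linearCombination ℝ x b‖ := by
    refine le_trans ?_ (hAB b).1
    have := abs_le_norm_linearCombination_c0Basis b j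
    rw [hbj] at this
    nlinarith
  have hBδ : B * δ₁ ≤ δ₁ / δ * ‖Finsupp.linearCombination ℝ x b‖ := by
    rw [div_le_div_iff₀ hA hδ, one_mul] at hK
    calc B * δ₁ = δ₁ / δ * (B * δ) := by field_simp
      _ ≤ _ := mul_le_mul_of_nonneg_left (hK.trans hAle) (by positivity)
  let p : ℕ → Prop := fun i => δ₁ ≤ |b i|
  have hsmall : ∀ i, |b.filter (¬ p ·) i| ≤ δ₁ :=
    abs_filter_le hδ₁.le _ fun i hi => (not_le.1 hi).le
  have h1 := hx (b.filter p) E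
    (fun i hi => by
      rw [Finsupp.support_filter, Finset.mem_filter] at hi
      rw [Finsupp.filter_apply_pos _ _ hi.2]
      exact hi.2) (abs_filter_le zero_le_one p fun i _ => hb1 i)
  have h2 : ‖∑ i ∈ E, b.filter (¬ p ·) i • x i‖ ≤ B * δ₁ := by
    rw [sum_eq_linearCombination_filter]
    exact hup _ _ (abs_filter_le hδ₁.le _ fun i _ => hsmall i)
  have h3 := hup _ _ hsmall
  have h4 : ‖Finsupp.linearCombination ℝ x (b.filter p)‖ ≤
      ‖Finsupp.linearCombination ℝ x b‖ + B * δ₁ := by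
    rw [eq_sub_of_add_eq (linearCombination_eq_filter_add x b p).symm]
    exact (norm_sub_le _ _).trans (add_le_add_right h3 _)
  rw [sum_filter_add_sum_filter_neg x b p E]
  calc _ ≤ c * ‖Finsupp.linearCombination ℝ x (b.filter p)‖ + B * δ₁ :=
        (norm_add_le _ _).trans (add_le_add h1 h2)
    _ ≤ c * (‖Finsupp.linearCombination ℝ x b‖ + δ₁ / δ * ‖Finsupp.linearCombination ℝ x b‖) +
        δ₁ / δ * ‖Finsupp.linearCombination ℝ x b‖ :=
      add_le_add (mul_le_mul_of_nonneg_left (h4.trans (by linarith)) hc) hBδ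
    _ = _ := by ring

end

/-! ### The two quantitative inequalities -/

theorem C_le_of_forall {δ : ℝ} {c : ℝ≥0} (h : ∀ (X : Type u) [NormedAddCommGroup X]
    [NormedSpace ℝ X] [CompleteSpace X] (x : ℕ → X), Normalized x →
    EquivalentWith (1 / δ) c0Basis x → ∃ φ : ℕ → ℕ, StrictMono φ ∧ UnconditionalWith c (x ∘ φ)) :
    C.{u} δ ≤ c :=
  iInf₂_le c h

theorem exists_of_C_lt {δ : ℝ} {r : ℝ≥0∞} (h : C.{u} δ < r) :
    ∃ c : ℝ≥0, (c : ℝ≥0∞) < r ∧ ∀ (X : Type u) [NormedAddCommGroup X]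
    [NormedSpace ℝ X] [CompleteSpace X] (x : ℕ → X), Normalized x →
    EquivalentWith (1 / δ) c0Basis x →
    ∃ φ : ℕ → ℕ, StrictMono φ ∧ UnconditionalWith c (x ∘ φ) := by
  simp only [C, iInf_lt_iff] at h
  obtain ⟨c, hc, hr⟩ := h
  exact ⟨c, hr, hc⟩

theorem C_le_mul_add {δ δ₁ : ℝ} (hδ : 0 < δ) (hδ₁ : 0 < δ₁) :
    C.{u} δ ≤ L.{u} δ₁ * (1 + ENNReal.ofReal (δ₁ / δ)) + ENNReal.ofReal (δ₁ / δ) := by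
  set o := ENNReal.ofReal (δ₁ / δ) with ho
  have key : ∀ c : ℝ≥0∞, L.{u} δ₁ < c → C.{u} δ ≤ c * (1 + o) + o := by
    intro c hc
    induction c with
    | top => rw [ENNReal.top_mul (by simp), top_add]; exact le_top
    | coe c =>
      have h1 : (c : ℝ≥0∞) * (1 + o) + o =
          ((c * (1 + (δ₁ / δ).toNNReal) + (δ₁ / δ).toNNReal : ℝ≥0) : ℝ≥0∞) := by
        push_cast; rfl
      rw [h1]
      refine C_le_of_forall fun X _ _ _ x hn hx => ?_
      obtain ⟨φ, hφ, hL⟩ := exists_subseq_of_L_lt hn hx.weaklyNull hc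
      refine ⟨φ, hφ, ?_⟩
      convert (hx.comp hφ).unconditionalWith hδ hδ₁ (hn.comp φ) c.2 hL using 1
      push_cast
      rw [Real.coe_toNNReal _ (by positivity)]
      rfl
  rcases eq_or_ne (L.{u} δ₁) ⊤ with h | h
  · rw [h, ENNReal.top_mul (by simp), top_add]; exact le_top
  have hne : (𝓝[>] (L.{u} δ₁)).NeBot := nhdsGT_neBot_of_exists_gt ⟨⊤, h.lt_top⟩
  have hlim : Tendsto (fun c : ℝ≥0∞ => c * (1 + o) + o) (𝓝[>] (L.{u} δ₁))
      (𝓝 (L.{u} δ₁ * (1 + o) + o)) :=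
    ((ENNReal.Tendsto.mul_const tendsto_id (Or.inr (by simp [ho]))).add_const o).mono_left
      nhdsWithin_le_nhds
  exact ge_of_tendsto hlim (eventually_mem_nhdsWithin.mono key)

theorem L'_le_C {δ δ₁ : ℝ} (hδ : 0 < δ) (hδ1 : δ ≤ 1) (hδ₁ : 0 < δ₁)
    (h : ENNReal.ofReal δ₁ < ENNReal.ofReal δ / (2 * L'.{u} δ)) : L'.{u} δ ≤ C.{u} δ₁ := by
  by_contra! hlt
  obtain ⟨c, hc, hC⟩ := exists_of_C_lt hlt
  -- The hypothesis on `δ₁` solved for L'. It lets some subsequence have a constant `Λ` with `2 * Λ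
  -- / δ < 1 / δ₁`, which is the room the renorming requires.
  have hL : L'.{u} δ < ENNReal.ofReal (δ / (2 * δ₁)) := by
    rcases eq_or_ne (L'.{u} δ) ⊤ with htop | htop
    · simp [htop] at h
    obtain ⟨l, hl⟩ : ∃ l : ℝ≥0, (l : ℝ≥0∞) = L'.{u} δ := ⟨_, ENNReal.coe_toNNReal htop⟩
    rw [← hl] at h hc ⊢
    have hl0 : 0 < (l : ℝ) := by exact_mod_cast (zero_le).trans_lt hc
    have h2 : (2 : ℝ≥0∞) * l = ENNReal.ofReal (2 * l) := by
      rw [ENNReal.ofReal_mul (by norm_num)]; simp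
    rw [h2, ← ENNReal.ofReal_div_of_pos (by positivity),
      ENNReal.ofReal_lt_ofReal_iff (by positivity), lt_div_iff₀ (by positivity)] at h
    rw [← ENNReal.ofReal_coe_nnreal, ENNReal.ofReal_lt_ofReal_iff (by positivity),
      lt_div_iff₀ (by positivity)]
    linarith
  have hc' := hc
  rw [L'] at hc'
  simp only [lt_iSup_iff] at hc'
  obtain ⟨X, _, _, _, x, hn, hx, hinf⟩ := hc'
  obtain ⟨φ, hφ, Λ, hΛ, hnear⟩ := exists_subseq_of_L'_lt hn hx hL
  have hT : 2 * (Λ : ℝ) / δ < 1 / δ₁ := by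
    rw [← ENNReal.ofReal_coe_nnreal, ENNReal.ofReal_lt_ofReal_iff (by positivity),
      lt_div_iff₀ (by positivity)] at hΛ
    rw [div_lt_div_iff₀ hδ hδ₁]
    linarith
  obtain ⟨Y, _, _, _, y, hy, hyc, hyu⟩ := exists_equivalentWith_c0Basis (hn.comp φ) (hx.comp hφ)
    hδ hδ1 hnear c.2 hT fun ψ hψ hnu => by
      have : LSeq' (x ∘ (φ ∘ ψ)) δ ≤ c := LSeq'_le hnu
      exact absurd hinf (not_lt.2 ((iInf₂_le _ (hφ.comp hψ)).trans this))
  obtain ⟨ψ, hψ, hu⟩ := hC Y y hy hyc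
  exact hyu ψ hψ hu

theorem L'_lt_top {δ : ℝ} (hδ : 0 < δ) : L'.{u} δ < ⊤ := by
  refine lt_of_le_of_lt ?_ (ENNReal.coe_lt_top (r := (16 / δ ^ 2).toNNReal))
  refine iSup_le fun X => iSup_le fun _ => iSup_le fun _ => iSup_le fun _ => iSup_le fun x =>
    iSup_le fun hn => iSup_le fun hx => ?_
  obtain ⟨φ, hφ, h⟩ := exists_subseq_nearUnconditional' hn hx hδ
  exact iInf₂_le_of_le φ hφ (LSeq'_le (h.mono (Real.le_coe_toNNReal _)))

/-! ### From L' to L by diagonalisation; normalization -/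

section
variable {X : Type u} [NormedAddCommGroup X] [NormedSpace ℝ X]

/-- The inequality defining `LSeq'`, for vectors with coordinates supported in `M`. -/
def NearUnconditionalOn (x : ℕ → X) (δ C : ℝ) (M : Set ℕ) : Prop :=
  ∀ (a : ℕ →₀ ℝ) (E : Finset ℕ), (a.support : Set ℕ) ⊆ M → (∀ i ∈ a.support, δ ≤ |a i|) →
    ‖Finsupp.linearCombination ℝ x a‖ ≤ 1 →
    ‖∑ i ∈ E, a i • x i‖ ≤ C * ‖Finsupp.linearCombination ℝ x a‖

theorem NearUnconditional'.nearUnconditionalOn_range {x : ℕ → X} {δ c : ℝ} {θ : ℕ → ℕ}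
    (hθ : StrictMono θ) (h : NearUnconditional' (x ∘ θ) δ c) :
    NearUnconditionalOn x δ c (Set.range θ) := by
  classical
  intro a E haM ha hna
  obtain ⟨d, rfl⟩ : ∃ d : ℕ →₀ ℝ, a = d.mapDomain θ :=
    ⟨a.comapDomain θ hθ.injective.injOn, (Finsupp.mapDomain_comapDomain _ hθ.injective _ haM).symm⟩
  have hsupp := Finsupp.mapDomain_support_of_injective hθ.injective d
  obtain ⟨E', -, hE'⟩ := Finset.subset_image_iff.1
    (Finset.inter_subset_right.trans_eq hsupp : E ∩ (d.mapDomain θ).support ⊆ d.support.image θ)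
  rw [sum_smul_eq_sum_inter, ← hE', ← sum_comp_eq_sum_mapDomain x hθ]
  rw [Finsupp.linearCombination_mapDomain] at hna ⊢
  refine h d E' (fun i hi => ?_) hna
  rw [← Finsupp.mapDomain_apply hθ.injective d i]
  exact ha _ (by rw [hsupp]; exact Finset.mem_image_of_mem _ hi)

theorem exists_nearUnconditionalOn [CompleteSpace X] {x : ℕ → X} (hn : Normalized x)
    (hx : WeaklyNull x) {δ : ℝ} {q : ℝ≥0} (hq : L'.{u} δ < q) {M : Set ℕ} (hM : M.Infinite) :
    ∃ N ⊆ M, N.Infinite ∧ NearUnconditionalOn x δ q N := by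
  have hp : StrictMono (Nat.nth (· ∈ M)) := Nat.nth_strictMono hM
  obtain ⟨ψ, hψ, c, hc, h⟩ := exists_subseq_of_L'_lt (hn.comp _) (hx.comp hp) hq
  refine ⟨Set.range (Nat.nth (· ∈ M) ∘ ψ), ?_,
    Set.infinite_range_of_injective (hp.comp hψ).injective,
    NearUnconditional'.nearUnconditionalOn_range (hp.comp hψ) (h.mono (by exact_mod_cast hc.le))⟩
  rintro _ ⟨k, rfl⟩
  exact Nat.nth_mem_of_infinite hM _

theorem norm_linearCombination_le_of_support_subset_range {x : ℕ → X} (hn : Normalized x)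
    {a : ℕ →₀ ℝ} (ha : ∀ i, |a i| ≤ 1) {k : ℕ} (hk : a.support ⊆ Finset.range k) :
    ‖Finsupp.linearCombination ℝ x a‖ ≤ k := by
  rw [Finsupp.linearCombination_apply, Finsupp.sum]
  calc ‖∑ i ∈ a.support, a i • x i‖ ≤ ∑ i ∈ a.support, 1 := norm_sum_le_of_le _ fun i _ => by
        rw [norm_smul, hn i, mul_one]; exact ha i
    _ ≤ k := by
      have := Finset.card_le_card hk
      rw [Finset.card_range] at this
      simpa using this

/-- If the constants `L'(δ)` are uniformly small, then the restriction to vectors of norm at most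
one can be replaced by the restriction to coefficients of modulus at most one. -/
theorem exists_subseq_nearUnconditional [CompleteSpace X] {x : ℕ → X} (hn : Normalized x)
    (hx : WeaklyNull x) {q r : ℝ≥0} (hqr : q < r)
    (hL : ∀ δ ∈ Set.Ioc (0 : ℝ) 1, L'.{u} δ < q) {δ : ℝ} (hδ : δ ∈ Set.Ioc (0 : ℝ) 1) :
    ∃ φ : ℕ → ℕ, StrictMono φ ∧ NearUnconditional (x ∘ φ) δ r := by
  classical
  have hqr' : (q : ℝ) < r := by exact_mod_cast hqr
  have hq0 : (0 : ℝ) ≤ q := q.2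
  -- Discarding coordinates of total norm at most `ε * t` costs `ε * (1 + q) * t`, exactly the room
  -- between `q` and `r`.
  set ε : ℝ := (r - q) / (1 + q) with hε
  have hε0 : 0 < ε := div_pos (by linarith) (by linarith)
  -- With `k = ⌊ε * t⌋₊` the remaining tail has norm at most `t + k ≤ τ k`, so dividing by `τ k`
  -- puts it in the unit ball. The final `+ 1` ensures `τ k ≥ 1`, hence `δ / τ k ≤ 1`.
  let τ : ℕ → ℝ := fun k => (k + 1) / ε + k + 1
  have hτ1 : ∀ k, 1 ≤ τ k := fun k => by
    have : 0 ≤ (k + 1 : ℝ) / ε + k := by positivity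
    simp only [τ]; linarith
  have hτ0 : ∀ k, 0 < τ k := fun k => one_pos.trans_le (hτ1 k)
  have hδτ : ∀ k, δ / τ k ∈ Set.Ioc (0 : ℝ) 1 := fun k =>
    ⟨div_pos hδ.1 (hτ0 k), (div_le_one (hτ0 k)).2 (hδ.2.trans (hτ1 k))⟩
  obtain ⟨M, -, hM, hM0⟩ := exists_nearUnconditionalOn hn hx (hL _ (hδτ 0)) Set.infinite_univ
  obtain ⟨φ, hφ, -, hQ⟩ := fusion
    (Q := fun t M => NearUnconditionalOn x (δ / τ t.card) q M)
    (fun t M N hN h a E haN => h a E (haN.trans hN))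
    (by
      intro t M hM htM _
      obtain ⟨p, hp⟩ := hM.nonempty
      obtain ⟨N, hN, hNi, h⟩ := exists_nearUnconditionalOn hn hx (hL _ (hδτ (t.card + 1)))
        (infinite_inter_Ioi hM p)
      refine ⟨p, hp, N, fun i hi => (hN hi).1, hNi, fun j hj => (hN hj).2, ?_⟩
      rwa [Finset.card_insert_of_notMem fun h => lt_irrefl _ (htM p h p hp)]) hM hM0
  refine ⟨φ, hφ, fun a E ha ha1 => ?_⟩
  set t := ‖Finsupp.linearCombination ℝ (x ∘ φ) a‖ with ht
  have ht0 : 0 ≤ t := norm_nonneg _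
  set k := ⌊ε * t⌋₊ with hk
  have hkt : (k : ℝ) ≤ ε * t := Nat.floor_le (by positivity)
  have htk : t ≤ (k + 1) / ε := by
    rw [le_div_iff₀ hε0, mul_comm]
    exact (Nat.lt_floor_add_one _).le
  let p : ℕ → Prop := fun i => k ≤ i
  have hsmall : ∀ b : ℕ →₀ ℝ, (∀ i, |b i| ≤ 1) → b.support ⊆ Finset.range k →
      ‖Finsupp.linearCombination ℝ (x ∘ φ) b‖ ≤ k := fun b hb hbs =>
    norm_linearCombination_le_of_support_subset_range (hn.comp φ) hb hbs
  have hs1 : ∀ i, |a.filter (¬ p ·) i| ≤ 1 := abs_filter_le zero_le_one _ fun i _ => ha1 i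
  have hss : (a.filter (¬ p ·)).support ⊆ Finset.range k := fun i hi => by
    rw [Finsupp.support_filter, Finset.mem_filter] at hi
    exact Finset.mem_range.2 (not_le.1 hi.2)
  have h1 := hsmall _ hs1 hss
  have h2 : ‖∑ i ∈ E, a.filter (¬ p ·) i • (x ∘ φ) i‖ ≤ k := by
    rw [sum_eq_linearCombination_filter]
    refine hsmall _ (abs_filter_le zero_le_one _ fun i _ => hs1 i) ?_
    rw [Finsupp.support_filter]
    exact (Finset.filter_subset _ _).trans hss
  have h3 : ‖Finsupp.linearCombination ℝ (x ∘ φ) (a.filter p)‖ ≤ t + k := by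
    rw [eq_sub_of_add_eq (linearCombination_eq_filter_add (x ∘ φ) a p).symm]
    exact (norm_sub_le _ _).trans (add_le_add_right h1 _)
  have h4 : ‖∑ i ∈ E, a.filter p i • (x ∘ φ) i‖ ≤
      q * ‖Finsupp.linearCombination ℝ (x ∘ φ) (a.filter p)‖ := by
    refine norm_sum_le_of_smul (inv_pos.2 (hτ0 k)) ?_
    have hQk := hQ k
    rw [Finset.card_image_of_injective _ hφ.injective, Finset.card_range] at hQk
    rw [← Finsupp.linearCombination_mapDomain, sum_comp_eq_sum_mapDomain x hφ]
    refine hQk _ _ ?_ (abs_mapDomain_ge hφ fun i hi => ?_) ?_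
    · rw [Finsupp.mapDomain_support_of_injective hφ.injective, Finset.coe_image]
      refine Set.image_mono fun i hi => ?_
      have := Finsupp.support_smul (Finset.mem_coe.1 hi)
      rw [Finsupp.support_filter, Finset.mem_filter] at this
      exact this.2
    · have := Finsupp.support_smul hi
      rw [Finsupp.support_filter, Finset.mem_filter] at this
      rw [Finsupp.smul_apply, Finsupp.filter_apply_pos _ _ this.2, smul_eq_mul, abs_mul,
        abs_of_pos (inv_pos.2 (hτ0 k)), ← div_eq_inv_mul]
      exact div_le_div_of_nonneg_right (ha i this.1) (hτ0 k).le
    · rw [Finsupp.linearCombination_mapDomain, map_smul, norm_smul,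
        Real.norm_of_nonneg (inv_pos.2 (hτ0 k)).le, inv_mul_le_one₀ (hτ0 k)]
      simp only [τ]
      linarith
  rw [sum_filter_add_sum_filter_neg (x ∘ φ) a p E]
  have h5 : ε * (1 + q) = r - q := div_mul_cancel₀ _ (by linarith)
  calc _ ≤ q * (t + k) + k :=
        (norm_add_le _ _).trans (add_le_add (h4.trans (mul_le_mul_of_nonneg_left h3 hq0)) h2)
    _ = q * t + k * (1 + q) := by ring
    _ ≤ q * t + ε * t * (1 + q) := by gcongr
    _ = r * t := by rw [mul_right_comm, h5]; ring

theorem EquivalentWith.normalize {K : ℝ} {x : ℕ → X} (h : EquivalentWith K c0Basis x) :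
    (∀ i, x i ≠ 0) ∧ ∃ δ ∈ Set.Ioc (0 : ℝ) 1,
      EquivalentWith (1 / δ) c0Basis fun i => ‖x i‖⁻¹ • x i := by
  obtain ⟨A, B, hA, hB, -, hAB⟩ := h
  have hx1 : ∀ i, Finsupp.linearCombination ℝ x (Finsupp.single i 1) = x i := fun i => by simp
  have hAx : ∀ i, A ≤ ‖x i‖ := fun i => by
    have h1 := (hAB (Finsupp.single i 1)).1
    have h2 := abs_le_norm_linearCombination_c0Basis (Finsupp.single i 1) i
    rw [hx1] at h1
    rw [Finsupp.single_eq_same, abs_one] at h2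
    nlinarith
  have hxB : ∀ i, ‖x i‖ ≤ B := fun i => by
    have h1 := (hAB (Finsupp.single i 1)).2
    have h2 : ‖Finsupp.linearCombination ℝ c0Basis (Finsupp.single i 1)‖ ≤ 1 :=
      norm_linearCombination_c0Basis_le fun j => by
        rw [Finsupp.single_apply]; split_ifs <;> simp
    rw [hx1] at h1
    nlinarith
  have hx0 : ∀ i, 0 < ‖x i‖ := fun i => hA.trans_le (hAx i)
  have hABle : A ≤ B := (hAx 0).trans (hxB 0)
  -- Since `A ≤ ‖x i‖ ≤ B`, normalizing changes the lower constant to `A / B` and the upper one to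
  -- `B / A`, whose quotient is `(B / A) ^ 2`.
  refine ⟨fun i => norm_pos_iff.1 (hx0 i), (A / B) ^ 2,
    ⟨by positivity, pow_le_one₀ (by positivity) ((div_le_one hB).2 hABle)⟩,
    A / B, B / A, by positivity, by positivity, le_of_eq (by field_simp), fun a => ?_⟩
  let c : ℕ →₀ ℝ := Finsupp.onFinset a.support (fun i => a i * ‖x i‖⁻¹) fun i hi => by
    rw [Finsupp.mem_support_iff]; exact left_ne_zero_of_mul hi
  have hc : ∀ i, c i = a i * ‖x i‖⁻¹ := fun i => rfl
  have hlc : Finsupp.linearCombination ℝ (fun i => ‖x i‖⁻¹ • x i) a =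
      Finsupp.linearCombination ℝ x c := by
    rw [Finsupp.linearCombination_apply, Finsupp.linearCombination_apply, Finsupp.sum,
      Finsupp.onFinset_sum _ (by simp)]
    exact Finset.sum_congr rfl fun i _ => smul_smul _ _ _
  rw [hlc]
  have habs : ∀ i, |c i| = |a i| * ‖x i‖⁻¹ := fun i => by
    rw [hc, abs_mul, abs_of_pos (inv_pos.2 (hx0 i))]
  constructor
  · have h1 : ‖Finsupp.linearCombination ℝ c0Basis a‖ ≤
        B * ‖Finsupp.linearCombination ℝ c0Basis c‖ :=
      norm_linearCombination_c0Basis_le fun i => by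
        have h2 := abs_le_norm_linearCombination_c0Basis c i
        calc |a i| = ‖x i‖ * |c i| := by rw [habs]; field_simp [(hx0 i).ne']
          _ ≤ _ := mul_le_mul (hxB i) h2 (abs_nonneg _) hB.le
    refine le_trans ?_ (hAB c).1
    rw [div_mul_eq_mul_div, div_le_iff₀ hB, mul_assoc, mul_comm _ B]
    exact mul_le_mul_of_nonneg_left h1 hA.le
  · have h1 : ‖Finsupp.linearCombination ℝ c0Basis c‖ ≤
        A⁻¹ * ‖Finsupp.linearCombination ℝ c0Basis a‖ :=
      norm_linearCombination_c0Basis_le fun i => by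
        rw [habs, mul_comm]
        exact mul_le_mul (inv_anti₀ hA (hAx i)) (abs_le_norm_linearCombination_c0Basis a i)
          (abs_nonneg _) (by positivity)
    refine (hAB c).2.trans ?_
    rw [div_eq_mul_inv, mul_assoc]
    exact mul_le_mul_of_nonneg_left h1 hB.le

theorem UnconditionalWith.of_normalize {x : ℕ → X} {c : ℝ} (hx : ∀ i, x i ≠ 0)
    (h : UnconditionalWith c fun i => ‖x i‖⁻¹ • x i) : UnconditionalWith c x := by
  refine ⟨hx, fun a E => ?_⟩
  let b : ℕ →₀ ℝ := Finsupp.onFinset a.support (fun i => a i * ‖x i‖) fun i hi => by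
    rw [Finsupp.mem_support_iff]; exact left_ne_zero_of_mul hi
  have hb : ∀ i, b i • ‖x i‖⁻¹ • x i = a i • x i := fun i => by
    change (a i * ‖x i‖) • ‖x i‖⁻¹ • x i = a i • x i
    rw [smul_smul, mul_assoc, mul_inv_cancel₀ (norm_ne_zero_iff.2 (hx i)), mul_one]
  have h1 := h.2 b E
  have h2 : Finsupp.linearCombination ℝ (fun i => ‖x i‖⁻¹ • x i) b =
      Finsupp.linearCombination ℝ x a := by
    rw [Finsupp.linearCombination_apply, Finsupp.linearCombination_apply, Finsupp.sum, Finsupp.sum]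
    rw [Finset.sum_subset Finsupp.support_onFinset_subset fun i _ hi => by
      rw [Finsupp.notMem_support_iff.1 hi, zero_smul]]
    exact Finset.sum_congr rfl fun i _ => hb i
  rw [h2] at h1
  simpa only [hb] using h1

end

/-! ### Comparison of the suprema -/

theorem L_le_of_forall_L'_le {Λ : ℝ≥0∞} (h : ∀ δ ∈ Set.Ioc (0 : ℝ) 1, L'.{u} δ ≤ Λ) {δ : ℝ}
    (hδ : δ ∈ Set.Ioc (0 : ℝ) 1) : L.{u} δ ≤ Λ := by
  refine le_of_forall_gt_imp_ge_of_dense fun s hs => ?_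
  obtain ⟨r, hΛr, hrs⟩ := ENNReal.lt_iff_exists_nnreal_btwn.1 hs
  obtain ⟨q, hΛq, hqr⟩ := ENNReal.lt_iff_exists_nnreal_btwn.1 hΛr
  refine le_trans ?_ hrs.le
  refine iSup_le fun X => iSup_le fun _ => iSup_le fun _ => iSup_le fun _ => iSup_le fun x =>
    iSup_le fun hn => iSup_le fun hx => ?_
  obtain ⟨φ, hφ, h⟩ := exists_subseq_nearUnconditional hn hx (by exact_mod_cast hqr)
    (fun δ hδ => (h δ hδ).trans_lt hΛq) hδ
  exact iInf₂_le_of_le φ hφ (LSeq_le h)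

theorem C_le_of_forall_L_le {Λ : ℝ≥0∞} (h : ∀ δ ∈ Set.Ioc (0 : ℝ) 1, L.{u} δ ≤ Λ) {δ : ℝ}
    (hδ : δ ∈ Set.Ioc (0 : ℝ) 1) : C.{u} δ ≤ Λ := by
  have hlim : Tendsto (fun n : ℕ => Λ * (1 + ENNReal.ofReal (1 / ((n : ℝ) + 1))) +
      ENNReal.ofReal (1 / ((n : ℝ) + 1))) atTop (𝓝 (Λ * (1 + 0) + 0)) := by
    have h0 : Tendsto (fun n : ℕ => ENNReal.ofReal (1 / ((n : ℝ) + 1))) atTop (𝓝 0) := by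
      simpa using ENNReal.tendsto_ofReal (tendsto_one_div_add_atTop_nhds_zero_nat (𝕜 := ℝ))
    exact (ENNReal.Tendsto.const_mul (h0.const_add 1) (Or.inl (by simp))).add h0
  rw [add_zero, add_zero, mul_one] at hlim
  refine ge_of_tendsto' hlim fun n => ?_
  have hn : (0 : ℝ) < 1 / ((n : ℝ) + 1) := by positivity
  have hn1 : 1 / ((n : ℝ) + 1) ≤ 1 := by
    rw [div_le_one (by positivity)]; linarith [n.cast_nonneg (α := ℝ)]
  -- With `δ₁ = δ / (n + 1)` the ratio `δ₁ / δ` tends to 0 while the bound `Λ` for L stays fixed.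
  have h1 := C_le_mul_add.{u} hδ.1 (mul_pos hδ.1 hn)
  rw [mul_div_cancel_left₀ _ hδ.1.ne'] at h1
  refine h1.trans ?_
  gcongr
  exact h _ ⟨mul_pos hδ.1 hn, mul_le_one₀ hδ.2 hn.le hn1⟩

/-- Elton's theorem makes L' finite at `δ`, so the threshold for `δ₁` is positive. -/
theorem exists_L'_le_C {δ : ℝ} (hδ : δ ∈ Set.Ioc (0 : ℝ) 1) :
    ∃ δ₁ ∈ Set.Ioc (0 : ℝ) 1, L'.{u} δ ≤ C.{u} δ₁ := by
  have hpos : 0 < ENNReal.ofReal δ / (2 * L'.{u} δ) :=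
    ENNReal.div_pos (by simpa using hδ.1)
      (ENNReal.mul_ne_top ENNReal.ofNat_ne_top (L'_lt_top hδ.1).ne)
  obtain ⟨r, hr0, hr⟩ := ENNReal.lt_iff_exists_nnreal_btwn.1 hpos
  have hr0' : (0 : ℝ) < r := by exact_mod_cast hr0
  refine ⟨min r 1, ⟨lt_min hr0' one_pos, min_le_right _ _⟩,
    L'_le_C hδ.1 hδ.2 (lt_min hr0' one_pos) (lt_of_le_of_lt ?_ hr)⟩
  rw [← ENNReal.ofReal_coe_nnreal]
  exact ENNReal.ofReal_le_ofReal (min_le_left _ _)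

/-- Unconditionality with a given constant is invariant under rescaling the vectors, so general
sequences reduce to normalized ones, at some level `δ` depending on the sequence; a bound uniform in
`δ` is what is needed. -/
theorem c0ProblemPositive_iff :
    C0ProblemPositive.{u} ↔ (⨆ δ ∈ Set.Ioc (0 : ℝ) 1, C.{u} δ) < ⊤ := by
  constructor
  · rintro ⟨c, hc⟩
    refine lt_of_le_of_lt (iSup₂_le fun δ _ => ?_) (ENNReal.coe_lt_top (r := c.toNNReal))
    refine C_le_of_forall fun X _ _ _ x _ hx => ?_
    obtain ⟨φ, hφ, h⟩ := hc X x ⟨_, hx⟩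
    exact ⟨φ, hφ, h.mono (Real.le_coe_toNNReal c)⟩
  · intro h
    obtain ⟨c, hc, -⟩ := ENNReal.lt_iff_exists_nnreal_btwn.1 h
    refine ⟨c, fun X _ _ _ x ⟨K, hK⟩ => ?_⟩
    obtain ⟨hx0, δ, hδ, hx⟩ := hK.normalize
    obtain ⟨c', hc', h'⟩ := exists_of_C_lt
      (lt_of_le_of_lt (le_iSup₂ (f := fun δ _ => C.{u} δ) δ hδ) hc)
    obtain ⟨φ, hφ, hu⟩ := h' X _ (fun i => by
      rw [norm_smul, norm_inv, norm_norm, inv_mul_cancel₀ (norm_ne_zero_iff.2 (hx0 i))]) hx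
    exact ⟨φ, hφ, (UnconditionalWith.of_normalize (fun i => hx0 (φ i)) hu).mono
      (by exact_mod_cast hc'.le)⟩

theorem iSup_C_le_iSup_L :
    (⨆ δ ∈ Set.Ioc (0 : ℝ) 1, C.{u} δ) ≤ ⨆ δ ∈ Set.Ioc (0 : ℝ) 1, L.{u} δ :=
  iSup₂_le fun _ hδ => C_le_of_forall_L_le
    (fun δ hδ => le_iSup₂ (f := fun δ _ => L.{u} δ) δ hδ) hδ

theorem iSup_L_le_iSup_L' :
    (⨆ δ ∈ Set.Ioc (0 : ℝ) 1, L.{u} δ) ≤ ⨆ δ ∈ Set.Ioc (0 : ℝ) 1, L'.{u} δ :=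
  iSup₂_le fun _ hδ => L_le_of_forall_L'_le
    (fun δ hδ => le_iSup₂ (f := fun δ _ => L'.{u} δ) δ hδ) hδ

theorem iSup_L'_le_iSup_C :
    (⨆ δ ∈ Set.Ioc (0 : ℝ) 1, L'.{u} δ) ≤ ⨆ δ ∈ Set.Ioc (0 : ℝ) 1, C.{u} δ :=
  iSup₂_le fun _ hδ => by
    obtain ⟨δ₁, hδ₁, h⟩ := exists_L'_le_C hδ
    exact h.trans (le_iSup₂ (f := fun δ _ => C.{u} δ) δ₁ hδ₁)

end C0Problem

theorem theorem5p1 :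
    (∀ δ δ₁ : ℝ, δ ∈ Set.Ioc (0 : ℝ) 1 → δ₁ ∈ Set.Ioc (0 : ℝ) 1 →
      (δ₁ ≤ δ →
        C0Problem.C.{u} δ ≤
          C0Problem.L.{u} δ₁ * (1 + ENNReal.ofReal (δ₁ / δ)) + ENNReal.ofReal (δ₁ / δ)) ∧
      (ENNReal.ofReal δ₁ < ENNReal.ofReal δ / (2 * C0Problem.L'.{u} δ) →
        C0Problem.L'.{u} δ ≤ C0Problem.C.{u} δ₁)) ∧
    (⨆ δ ∈ Set.Ioc (0 : ℝ) 1, C0Problem.C.{u} δ) =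
      (⨆ δ ∈ Set.Ioc (0 : ℝ) 1, C0Problem.L'.{u} δ) ∧
    (⨆ δ ∈ Set.Ioc (0 : ℝ) 1, C0Problem.L'.{u} δ) =
      (⨆ δ ∈ Set.Ioc (0 : ℝ) 1, C0Problem.L.{u} δ) ∧
    (C0Problem.C0ProblemPositive.{u} ↔
      (⨆ δ ∈ Set.Ioc (0 : ℝ) 1, C0Problem.L.{u} δ) < ⊤) := by
  have hCL := C0Problem.iSup_C_le_iSup_L.{u}
  have hLL := C0Problem.iSup_L_le_iSup_L'.{u}
  have hLC := C0Problem.iSup_L'_le_iSup_C.{u}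
  refine ⟨fun δ δ₁ hδ hδ₁ => ⟨fun _ => C0Problem.C_le_mul_add hδ.1 hδ₁.1,
    C0Problem.L'_le_C hδ.1 hδ.2 hδ₁.1⟩, le_antisymm (hCL.trans hLL) hLC,
    le_antisymm (hLC.trans hCL) hLL, ?_⟩
  rw [C0Problem.c0ProblemPositive_iff, le_antisymm hCL (hLL.trans hLC)]
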